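/- Let $n\ge 1$, let $\lambda=(\lambda_1\ge\lambda_2\ge\dots\ge\lambda_n)$ be integers, let $p$ be a prime number and $K=\overline{\mathbb F}_p$. Let $\mathfrak g$ be $\mathfrak{sl}_n(K)$ or $\mathfrak{gl}_n(K)$, let $\mathfrak b\subset\mathfrak g$ be the subalgebra of upper triangular matrices, and let $K_\lambda$ be the one-dimensional $\mathfrak b$-module on which $x\in\mathfrak b$ acts by $\sum_i\lambda_i x_{ii}$. Let $M(\lambda,p)=U(\mathfrak g)\otimes_{U(\mathfrak b)}K_\lambda$ be the Verma module, with highest weight vector $v_\lambda$, where $U$ denotes the universal enveloping algebra. Put $f_i=E_{i+1,i}$ for $1\le i\le n-1$. The Weyl module $V(\lambda,p)$ is the quotient of $M(\lambda,p)$ by the $U(\mathfrak g)$-submodule generated by the vectors $f_i^{\lambda_i-\lambda_{i+1}+1}v_\lambda$, $1\le i\le n-1$. If $p>\lambda_1-\lambda_n+n$, then $V(\lambda,p)$ is an irreducible $\mathfrak g$-module, both for $\mathfrak g=\mathfrak{sl}_n(K)$ and for $\mathfrak g=\mathfrak{gl}_n(K)$. -/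

import Mathlib

attribute [local instance 100] LieRing.ofAssociativeRing

noncomputable section

namespace WeylModP

section General

/-! Highest weight modules over a Lie algebra `L` over a field `K`. A representation of `L` is a
left module over the universal enveloping algebra `U(L)`. -/

variable (K : Type*) [Field K] {L : Type*} [LieRing L] [LieAlgebra K L]

/-- The left ideal of `U(L)` generated by the elements `x - χ(x)`, for `x` in the subalgebra `b`. -/
def vermaIdeal (b : LieSubalgebra K L) (χ : L →ₗ[K] K) :
    Submodule (UniversalEnvelopingAlgebra K L) (UniversalEnvelopingAlgebra K L) :=
  Submodule.span (UniversalEnvelopingAlgebra K L)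
    {u | ∃ x ∈ b, u = UniversalEnvelopingAlgebra.ι K x -
      algebraMap K (UniversalEnvelopingAlgebra K L) (χ x)}

/-- The Verma module `U(L) ⊗_{U(b)} K_χ`, as the quotient of `U(L)` by the left ideal generated
by the elements `x - χ(x)`, `x ∈ b`. -/
abbrev VermaModule (b : LieSubalgebra K L) (χ : L →ₗ[K] K) : Type _ :=
  UniversalEnvelopingAlgebra K L ⧸ vermaIdeal K b χ

/-- The highest weight vector: the class of `1`. -/
def highestWeightVector (b : LieSubalgebra K L) (χ : L →ₗ[K] K) : VermaModule K b χ :=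
  Submodule.Quotient.mk 1

/-- The submodule of the Verma module generated by the vectors `f_s ^ (m_s + 1) • v`, where `v` is
the highest weight vector and `s` runs over an index set `S`. -/
def weylSubmodule (b : LieSubalgebra K L) (χ : L →ₗ[K] K) {S : Type*} (f : S → L) (m : S → ℕ) :
    Submodule (UniversalEnvelopingAlgebra K L) (VermaModule K b χ) :=
  Submodule.span (UniversalEnvelopingAlgebra K L)
    (Set.range fun s : S =>
      UniversalEnvelopingAlgebra.ι K (f s) ^ (m s + 1) • highestWeightVector K b χ)

/-- The quotient of the Verma module by the submodule generated by the `f_s ^ (m_s + 1) • v`. -/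
abbrev WeylQuotient (b : LieSubalgebra K L) (χ : L →ₗ[K] K) {S : Type*} (f : S → L) (m : S → ℕ) :
    Type _ :=
  VermaModule K b χ ⧸ weylSubmodule K b χ f m

end General

section TypeA

variable (K : Type*) [Field K] (n : ℕ)

/-- The Borel subalgebra of upper triangular matrices in `gl_n`. -/
def glBorel : LieSubalgebra K (Matrix (Fin n) (Fin n) K) where
  carrier := {x | ∀ i j : Fin n, j < i → x i j = 0}
  add_mem' := by
    intro x y hx hy i j hij
    simp [hx i j hij, hy i j hij]
  zero_mem' := by
    intro i j _
    rfl
  smul_mem' := by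
    intro c x hx i j hij
    simp [hx i j hij]
  lie_mem' := by
    have key : ∀ x y : Matrix (Fin n) (Fin n) K, (∀ i j : Fin n, j < i → x i j = 0) →
        (∀ i j : Fin n, j < i → y i j = 0) → ∀ i j : Fin n, j < i → (x * y) i j = 0 := by
      intro x y hx hy i j hij
      rw [Matrix.mul_apply]
      refine Finset.sum_eq_zero fun k _ => ?_
      rcases lt_or_ge k i with h | h
      · rw [hx i k h, zero_mul]
      · rw [hy k j (lt_of_lt_of_le hij h), mul_zero]
    intro x y hx hy i j hij
    rw [Ring.lie_def, Matrix.sub_apply, key x y hx hy i j hij, key y x hy hx i j hij, sub_zero]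

/-- The Borel subalgebra of upper triangular matrices in `sl_n`. -/
def slBorel : LieSubalgebra K (LieAlgebra.SpecialLinear.sl (Fin n) K) :=
  (glBorel K n).comap (LieAlgebra.SpecialLinear.sl (Fin n) K).incl

variable {n}

/-- The linear functional `x ↦ ∑ i, λ_i x_{ii}` on `gl_n`, with the integers `λ_i` read in `K`. -/
def glWeight (lam : Fin n → ℤ) : Matrix (Fin n) (Fin n) K →ₗ[K] K :=
  ∑ i : Fin n, (lam i : K) • Matrix.entryLinearMap K K i i

/-- The same functional on `sl_n`. -/
def slWeight (lam : Fin n → ℤ) : LieAlgebra.SpecialLinear.sl (Fin n) K →ₗ[K] K :=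
  (glWeight K lam).comp (LieAlgebra.SpecialLinear.sl (Fin n) K).incl.toLinearMap

variable (n)

/-- The simple roots `ε_i - ε_j`, `j = i + 1`, of type `A_{n-1}`. -/
abbrev SimpleRoot : Type := {s : Fin n × Fin n // (s.1 : ℕ) + 1 = (s.2 : ℕ)}

variable {n}

/-- The label `λ_i - λ_{i+1}` (a natural number when `λ` is dominant) of a weight at a simple
root. -/
def label (lam : Fin n → ℤ) (s : SimpleRoot n) : ℕ := (lam s.1.1 - lam s.1.2).toNat

/-- The lowering element `f_i = E_{i+1,i}` of `gl_n`. -/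
def glF (s : SimpleRoot n) : Matrix (Fin n) (Fin n) K := Matrix.single s.1.2 s.1.1 1

theorem glF_mem_sl (s : SimpleRoot n) : glF K s ∈ LieAlgebra.SpecialLinear.sl (Fin n) K := by
  have h : s.1.2 ≠ s.1.1 := by
    intro h
    have := s.2
    rw [h] at this
    omega
  exact (LieAlgebra.SpecialLinear.single s.1.2 s.1.1 h (1 : K)).2

/-- The lowering element `f_i = E_{i+1,i}` of `sl_n`. -/
def slF (s : SimpleRoot n) : LieAlgebra.SpecialLinear.sl (Fin n) K := ⟨glF K s, glF_mem_sl K s⟩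

/-- The Weyl module of `gl_n` with highest weight `λ`, over the field `K`. -/
abbrev GlWeylModule (lam : Fin n → ℤ) : Type _ :=
  WeylQuotient K (glBorel K n) (glWeight K lam) (glF K) (label lam)

/-- The Weyl module of `sl_n` with highest weight (the restriction of) `λ`, over the field `K`. -/
abbrev SlWeylModule (lam : Fin n → ℤ) : Type _ :=
  WeylQuotient K (slBorel K n) (slWeight K lam) (slF K) (label lam)

end TypeA

end WeylModP

end

/-! Let `v` be the highest weight vector of the Weyl module, viewed as a module over matrix units `E
i j`. Weights are tracked as integer vectors attached to words in the `E i j`, not as residues mod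
`p`.

Bounding weights: if `m = λ_i - λ_{i+1}`, then `f_i ^ m v` satisfies the Weyl relations for the
Borel subalgebra reflected in the `i`-th simple root (`IsWeylVector.reflect`), and `e_i ^ m` brings
it back to a nonzero multiple of `v`. The coefficients that occur are products of integers between
`1` and `p - 1`. Iterating over permutations shows that each coordinate of each weight lies in
`[λ_n, λ_1]` (`IsWeylVector.weight_bounds`). Hence there are finitely many weights, and they stay
distinct mod `p`.

Irreducibility: a nonzero submodule contains a weight vector, hence a singular one `w`, of weight
`μ`. By `sl_2` theory `μ` is dominant. The traces of the powers of the matrix `(E i j)` are central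
and act on `v` and `w` by the same scalars. As `p > λ_1 - λ_n + n`, these scalars determine the
`ρ`-shifted weight, not merely up to linkage (`eq_of_sum_diagEigenvalue_eq`). So `μ = λ`, `w` is a
multiple of `v`, and the submodule is everything (`IsWeylVector.eq_top`).

Nonvanishing: a product of powers of leading principal minors in a polynomial ring satisfies the
defining relations of `v`. For `sl_n`, `n` is invertible mod `p`, so the action extends to `gl_n`
with a scalar action of the identity. -/

namespace GlRep

/-! ### Strings for `sl_2` and the Heisenberg relations. -/

section Operators

variable {K V : Type*} [Field K] [AddCommGroup V] [Module K V]

/-- Lie algebra `sl_2`: the weights of the vectors `f ^ k v`. -/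
theorem sl2_weight {f h : Module.End K V} (hf : h * f - f * h = (-2 : K) • f) {c : K} {v : V}
    (hv : h v = c • v) (k : ℕ) : h ((f ^ k) v) = (c - 2 * k) • (f ^ k) v := by
  induction k with
  | zero => simp [hv]
  | succ k ih =>
    have h1 := LinearMap.congr_fun hf ((f ^ k) v)
    simp only [LinearMap.sub_apply, Module.End.mul_apply, LinearMap.smul_apply, ih,
      map_smul] at h1
    rw [pow_succ', Module.End.mul_apply, eq_add_of_sub_eq h1, ← add_smul]
    congr 1
    push_cast
    ring

/-- Moving `e` to the right past each `f` produces the eigenvalues `c - 2t`, `0 ≤ t ≤ k`, whose sum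
is the stated coefficient. -/
theorem sl2_raise {e f h : Module.End K V} (hef : e * f - f * e = h)
    (hf : h * f - f * h = (-2 : K) • f) {c : K} {v : V} (he : e v = 0) (hv : h v = c • v)
    (k : ℕ) : e ((f ^ (k + 1)) v) = ((k + 1 : K) * (c - k)) • (f ^ k) v := by
  induction k with
  | zero =>
    have h1 := LinearMap.congr_fun hef v
    simp only [LinearMap.sub_apply, Module.End.mul_apply, he, map_zero, sub_zero, hv] at h1
    simp [h1]
  | succ k ih =>
    have h1 := LinearMap.congr_fun hef ((f ^ (k + 1)) v)
    simp only [LinearMap.sub_apply, Module.End.mul_apply] at h1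
    rw [sl2_weight hf hv, ih, map_smul, ← Module.End.mul_apply f (f ^ k), ← pow_succ'] at h1
    rw [pow_succ' f (k + 1), Module.End.mul_apply, eq_add_of_sub_eq h1, ← add_smul]
    congr 1
    push_cast
    ring

/-- In a string of length `m < p`, the raising operator inverts the lowering operator up to a
nonzero scalar. -/
theorem sl2_raise_pow {p : ℕ} [CharP K p] {e f h : Module.End K V} (hef : e * f - f * e = h)
    (hf : h * f - f * h = (-2 : K) • f) {m : ℕ} (hm : m < p) {v : V} (he : e v = 0)
    (hv : h v = (m : K) • v) (j k : ℕ) (hkj : k + j ≤ m) :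
    ∃ d : K, d ≠ 0 ∧ (e ^ j) ((f ^ (k + j)) v) = d • (f ^ k) v := by
  induction j with
  | zero => exact ⟨1, one_ne_zero, by simp⟩
  | succ j ih =>
    obtain ⟨d, hd, hd'⟩ := ih (by omega)
    have h1 := sl2_raise hef hf he hv (k + j)
    -- Both new factors are integers between `1` and `m < p`, so neither vanishes in `K`.
    refine ⟨((k + j + 1 : ℕ) : K) * ((m - (k + j) : ℕ) : K) * d, ?_, ?_⟩
    · refine mul_ne_zero (mul_ne_zero ?_ ?_) hd
      all_goals
        rw [Ne, CharP.cast_eq_zero_iff K p]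
        exact fun hdvd => absurd (Nat.le_of_dvd (by omega) hdvd) (by omega)
    · rw [pow_succ, Module.End.mul_apply, ← add_assoc, h1, map_smul, hd', smul_smul]
      congr 2
      rw [Nat.cast_sub (by omega)]
      push_cast
      ring

/-- Heisenberg relations: the powers of the commutator `z = [x, y]`. -/
theorem heisenberg_pow {x y z : Module.End K V} (hz : x * y - y * x = z) (hxz : Commute x z)
    (N : ℕ) : x ^ (N + 1) * y = y * x ^ (N + 1) + ((N + 1 : ℕ) : K) • (z * x ^ N) := by
  have hxy : x * y = y * x + z := by rw [← hz]; abel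
  induction N with
  | zero => simp [hxy]
  | succ N ih =>
    have h2 : x * (z * x ^ N) = z * x ^ (N + 1) := by
      rw [← mul_assoc, hxz.eq, mul_assoc, ← pow_succ']
    rw [pow_succ', mul_assoc, ih, mul_add, ← mul_assoc, hxy, mul_smul_comm, h2, add_mul, mul_assoc,
      ← pow_succ', add_assoc]
    congr 1
    push_cast
    module

/-- In the induction, the term with `y` on the left contains `x ^ (a + 1) v = 0` once `x` has been
moved past `z`; only the commutator term survives. It is not needed that `y` commutes with `z`. -/
theorem heisenberg_pow_apply {x y z : Module.End K V} (hz : x * y - y * x = z)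
    (hxz : Commute x z) {a : ℕ} {v : V} (hx : (x ^ (a + 1)) v = 0) (M : ℕ) :
    (x ^ (a + M)) ((y ^ M) v) = ((a + 1).ascFactorial M : K) • (z ^ M) ((x ^ a) v) := by
  induction M with
  | zero => simp
  | succ M ih =>
    have h1 := LinearMap.congr_fun (heisenberg_pow (K := K) hz hxz (a + M)) ((y ^ M) v)
    simp only [LinearMap.add_apply, LinearMap.smul_apply, Module.End.mul_apply, ih, map_smul,
      smul_smul] at h1
    rw [pow_succ' y, Module.End.mul_apply, ← add_assoc, h1, pow_succ' x, Module.End.mul_apply, ih,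
      map_smul, ← Module.End.mul_apply x, (hxz.pow_right M).eq, Module.End.mul_apply,
      ← Module.End.mul_apply x, ← pow_succ', hx, map_smul, pow_succ' z, Module.End.mul_apply,
      Nat.ascFactorial_succ]
    simp only [map_zero, smul_zero, zero_add]
    congr 1
    push_cast
    ring

/-- Take `M = b + 1` above: the left side vanishes, and the coefficient divides `(a + b + 1)!`,
which is prime to `p`. -/
theorem heisenberg_nilpotent {p : ℕ} [Fact p.Prime] [CharP K p] {x y z : Module.End K V}
    (hz : x * y - y * x = z) (hxz : Commute x z) {a b : ℕ} (hab : a + b + 1 < p) {v : V}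
    (hx : (x ^ (a + 1)) v = 0) (hy : (y ^ (b + 1)) v = 0) :
    (z ^ (b + 1)) ((x ^ a) v) = 0 := by
  have h1 := heisenberg_pow_apply hz hxz hx (b + 1)
  rw [hy, map_zero] at h1
  refine (smul_eq_zero.mp h1.symm).resolve_left ?_
  intro h0
  have hdvd := (CharP.cast_eq_zero_iff K p _).mp h0
  have h2 : p ∣ (a + (b + 1)).factorial := by
    rw [← Nat.factorial_mul_ascFactorial]
    exact hdvd.mul_left _
  have := ((Fact.out : p.Prime).dvd_factorial).mp h2
  omega

end Operators

/-! ### Words in the matrix units, with integral weights. -/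

section Words

variable {K V : Type*} [Field K] [AddCommGroup V] [Module K V] {n : ℕ}

/-- The operators `E i j` satisfy the commutation relations of the matrix units of `gl_n`. -/
def IsMatrixUnits (E : Fin n → Fin n → Module.End K V) : Prop :=
  ∀ a b c d, E a b * E c d - E c d * E a b =
    (if b = c then E a d else 0) - (if d = a then E c b else 0)

theorem IsMatrixUnits.apply {E : Fin n → Fin n → Module.End K V} (hE : IsMatrixUnits E)
    (a b c d : Fin n) (x : V) : E a b (E c d x) =
      E c d (E a b x) + ((if b = c then E a d x else 0) - (if d = a then E c b x else 0)) := by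
  have h := LinearMap.congr_fun (hE a b c d) x
  simp only [LinearMap.sub_apply, Module.End.mul_apply] at h
  rw [eq_add_of_sub_eq' h]
  congr 2 <;> split_ifs <;> rfl

theorem IsMatrixUnits.comp {E : Fin n → Fin n → Module.End K V} (hE : IsMatrixUnits E)
    (s : Equiv.Perm (Fin n)) : IsMatrixUnits fun i j => E (s i) (s j) := by
  intro a b c d
  simpa using hE (s a) (s b) (s c) (s d)

theorem IsMatrixUnits.commute {E : Fin n → Fin n → Module.End K V} (hE : IsMatrixUnits E)
    {a b c d : Fin n} (hbc : b ≠ c) (hda : d ≠ a) : Commute (E a b) (E c d) := by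
  have h := hE a b c d
  rw [if_neg hbc, if_neg hda, sub_zero, sub_eq_zero] at h
  exact h

/-- The weight `ε_a - ε_b`. -/
abbrev root (a b : Fin n) : Fin n → ℤ := Pi.single a 1 - Pi.single b 1

/-- `Word E S lam v μ x`: the vector `x` is obtained from `v`, a vector of weight `lam`, by
applying operators `E a b` with `S a b`, and its weight is `μ`. -/
inductive Word (E : Fin n → Fin n → Module.End K V) (S : Fin n → Fin n → Prop)
    (lam : Fin n → ℤ) (v : V) : (Fin n → ℤ) → V → Prop
  | base : Word E S lam v lam v
  | step {μ x} (a b : Fin n) (hab : S a b) (h : Word E S lam v μ x) :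
      Word E S lam v (μ + root a b) (E a b x)

/-- The span of the words of weight `μ`. -/
def wordSpan (E : Fin n → Fin n → Module.End K V) (S : Fin n → Fin n → Prop)
    (lam : Fin n → ℤ) (v : V) (μ : Fin n → ℤ) : Submodule K V :=
  Submodule.span K {x | Word E S lam v μ x}

variable {E : Fin n → Fin n → Module.End K V} {S : Fin n → Fin n → Prop} {lam : Fin n → ℤ} {v : V}

theorem apply_mem_wordSpan {a b : Fin n} (hab : S a b) {μ : Fin n → ℤ} {x : V}
    (hx : x ∈ wordSpan E S lam v μ) : E a b x ∈ wordSpan E S lam v (μ + root a b) := by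
  have h : wordSpan E S lam v μ ≤ (wordSpan E S lam v (μ + root a b)).comap (E a b) :=
    Submodule.span_le.mpr fun y hy => Submodule.subset_span (Word.step a b hab hy)
  exact h hx

theorem pow_apply_mem_wordSpan {a b : Fin n} (hab : S a b) {μ : Fin n → ℤ} {x : V}
    (hx : x ∈ wordSpan E S lam v μ) (k : ℕ) :
    (E a b ^ k) x ∈ wordSpan E S lam v (μ + k • root a b) := by
  induction k with
  | zero => simpa using hx
  | succ k ih =>
    rw [pow_succ', Module.End.mul_apply, succ_nsmul, ← add_assoc]
    exact apply_mem_wordSpan hab ih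

theorem self_mem_wordSpan : v ∈ wordSpan E S lam v lam := Submodule.subset_span Word.base

/-- A highest weight vector of weight `lam` for the operators `E i j`, killed by the same powers
of the lowering operators as in a Weyl module. -/
structure IsWeylVector (E : Fin n → Fin n → Module.End K V) (lam : Fin n → ℤ) (v : V) : Prop where
  rel : IsMatrixUnits E
  sing : ∀ i j, i < j → E i j v = 0
  weight : ∀ i, E i i v = (lam i : K) • v
  nil : ∀ i j : Fin n, (i : ℕ) + 1 = j → (E j i ^ ((lam i - lam j).toNat + 1)) v = 0

theorem apply_diag_of_mem_wordSpan (hE : IsMatrixUnits E) (hw : ∀ i, E i i v = (lam i : K) • v)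
    {μ : Fin n → ℤ} {x : V} (hx : x ∈ wordSpan E S lam v μ) (i : Fin n) :
    E i i x = (μ i : K) • x := by
  suffices h : ∀ μ y, Word E S lam v μ y → E i i y = (μ i : K) • y by
    refine Submodule.span_induction (fun y hy => h μ y hy) (by simp) ?_ ?_ hx
    · intro y z _ _ hy hz
      rw [map_add, hy, hz, smul_add]
    · intro c y _ hy
      rw [map_smul, hy, smul_comm]
  intro μ y hy
  induction hy with
  | base => exact hw i
  | step a b _ _ ih =>
    rw [hE.apply, ih, map_smul, Pi.add_apply, root, Pi.sub_apply, Pi.single_apply, Pi.single_apply]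
    push_cast
    rw [add_smul, sub_smul]
    congr 2
    · split_ifs with h
      · rw [h, one_smul]
      · rw [zero_smul]
    · by_cases h : b = i
      · rw [if_pos h, if_pos h.symm, h, one_smul]
      · rw [if_neg h, if_neg (Ne.symm h), zero_smul]

/-- A highest weight vector generates its module under the lowering operators alone. -/
theorem mem_wordSpan_lower (hE : IsMatrixUnits E) (hs : ∀ i j, i < j → E i j v = 0)
    (hw : ∀ i, E i i v = (lam i : K) • v) {μ : Fin n → ℤ} {x : V}
    (hx : x ∈ wordSpan E S lam v μ) : x ∈ wordSpan E (fun a b => b < a) lam v μ := by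
  -- The lowering words span a stable subspace: moving `E a b` past the outermost lowering operator
  -- leaves cases covered by induction on the word, and on `v` itself raising operators give `0` and
  -- diagonal ones scalars.
  have key : ∀ μ y, Word E (fun a b => b < a) lam v μ y → ∀ a b,
      E a b y ∈ wordSpan E (fun a b => b < a) lam v (μ + root a b) := by
    intro μ y hy
    induction hy with
    | base =>
      intro a b
      rcases lt_trichotomy a b with h | h | h
      · rw [hs a b h]
        exact zero_mem _
      · subst h
        rw [hw a]
        rw [root, sub_self, add_zero]
        exact Submodule.smul_mem _ _ self_mem_wordSpan
      · exact apply_mem_wordSpan (S := fun a b => b < a) h self_mem_wordSpan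
    | @step μ y c d hcd _ ih =>
      intro a b
      rw [hE.apply]
      refine add_mem ?_ (sub_mem ?_ ?_)
      · rw [add_right_comm]
        exact apply_mem_wordSpan (S := fun a b => b < a) hcd (ih a b)
      · split_ifs with h
        · subst h
          convert ih a d using 2
          simp only [root]; abel
        · exact zero_mem _
      · split_ifs with h
        · subst h
          convert ih c b using 2
          simp only [root]; abel
        · exact zero_mem _
  suffices h : ∀ μ y, Word E S lam v μ y → y ∈ wordSpan E (fun a b => b < a) lam v μ from
    Submodule.span_le.mpr (fun y hy => h μ y hy) hx
  intro μ y hy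
  induction hy with
  | base => exact self_mem_wordSpan
  | @step μ y a b _ _ ih =>
    refine Submodule.span_induction (p := fun z _ => E a b z ∈ wordSpan E _ lam v (μ + root a b))
      (fun z hz => key μ z hz a b) (by simp) ?_ ?_ ih
    · intro z w _ _ hz hw
      rw [map_add]
      exact add_mem hz hw
    · intro c z _ hz
      rw [map_smul]
      exact Submodule.smul_mem _ _ hz

/-- A weight functional which does not decrease under lowering is at least its value at the
highest weight. -/
theorem word_lower_le (φ : (Fin n → ℤ) →+ ℤ) (hφ : ∀ a b : Fin n, b < a → 0 ≤ φ (root a b))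
    {μ : Fin n → ℤ} {x : V} (hx : Word E (fun a b => b < a) lam v μ x) : φ lam ≤ φ μ := by
  induction hx with
  | base => exact le_rfl
  | step a b hab _ ih =>
    rw [map_add]
    linarith [hφ a b hab]

theorem wordSpan_lower_eq_bot (φ : (Fin n → ℤ) →+ ℤ)
    (hφ : ∀ a b : Fin n, b < a → 0 ≤ φ (root a b)) {μ : Fin n → ℤ} (hμ : φ μ < φ lam) :
    wordSpan E (fun a b => b < a) lam v μ = ⊥ := by
  rw [wordSpan, Submodule.span_eq_bot]
  intro x hx
  exact absurd (word_lower_le φ hφ hx) (not_le.mpr hμ)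

/-- The functional `μ ↦ ∑ i, i μ_i` on weights; lowering increases it. -/
def depth : (Fin n → ℤ) →+ ℤ where
  toFun μ := ∑ i : Fin n, ((i : ℕ) : ℤ) * μ i
  map_zero' := by simp
  map_add' μ ν := by simp [mul_add, Finset.sum_add_distrib]

theorem depth_root (a b : Fin n) : depth (root a b) = ((a : ℕ) : ℤ) - ((b : ℕ) : ℤ) := by
  rw [root, map_sub]
  simp [depth, Pi.single_apply]

/-- Every lowering step strictly increases `depth`, so the empty word is the only lowering word of
weight `lam`. -/
theorem wordSpan_lower_self_le : wordSpan E (fun a b => b < a) lam v lam ≤ Submodule.span K {v} := by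
  refine Submodule.span_le.mpr fun x hx => ?_
  have key : ∀ μ x, Word E (fun a b => b < a) lam v μ x → x = v ∨ depth lam < depth μ := by
    intro μ x h
    cases h with
    | base => exact Or.inl rfl
    | step a b hab h =>
      right
      have h1 := word_lower_le depth (fun a b hab => by
        rw [depth_root]; have := Fin.lt_def.mp hab; omega) h
      rw [map_add, depth_root]
      have := Fin.lt_def.mp hab
      omega
  rcases key lam x hx with rfl | h
  · exact Submodule.mem_span_singleton_self _
  · exact absurd h (lt_irrefl _)

end Words

end GlRep

/-! ### Reflections, extremal vectors and the bound on weights. -/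

namespace GlRep

variable {K V : Type*} [Field K] [AddCommGroup V] [Module K V] {n : ℕ}
variable {E : Fin n → Fin n → Module.End K V} {lam : Fin n → ℤ} {v : V}

theorem IsMatrixUnits.e_f (hE : IsMatrixUnits E) (i j : Fin n) :
    E i j * E j i - E j i * E i j = E i i - E j j := by
  simpa using hE i j j i

theorem IsMatrixUnits.h_f (hE : IsMatrixUnits E) {i j : Fin n} (hij : i ≠ j) :
    (E i i - E j j) * E j i - E j i * (E i i - E j j) = (-2 : K) • E j i := by
  have h1 := hE i i j i
  have h2 := hE j j j i
  rw [if_neg hij, if_pos rfl] at h1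
  rw [if_pos rfl, if_neg hij] at h2
  rw [sub_mul, mul_sub, sub_sub_sub_comm, h1, h2]
  module

variable {p : ℕ} [CharP K p]

/-- The vector obtained by a simple reflection from a highest weight vector is killed by the
simple lowering operators of the reflected Borel subalgebra to the same powers. -/
theorem IsWeylVector.reflect [Fact p.Prime] (hv : IsWeylVector E lam v) (hlam : Antitone lam)
    (hp : ∀ a b, lam a - lam b + 1 < (p : ℤ)) {i j : Fin n} (hij : (i : ℕ) + 1 = j) :
    IsWeylVector (fun a b => E (Equiv.swap i j a) (Equiv.swap i j b)) lam
      ((E j i ^ (lam i - lam j).toNat) v) := by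
  have hlt : i < j := Fin.lt_def.mpr (by omega)
  have hne : i ≠ j := hlt.ne
  set m := (lam i - lam j).toNat with hm
  have hmij : (m : ℤ) = lam i - lam j := Int.toNat_of_nonneg (sub_nonneg.mpr (hlam hlt.le))
  have hmp : m < p := by have := hp i j; omega
  have hwt : ∀ a, E a a ((E j i ^ m) v) = (lam (Equiv.swap i j a) : K) • (E j i ^ m) v := by
    intro a
    rw [apply_diag_of_mem_wordSpan (S := fun _ _ => True) hv.rel hv.weight
      (pow_apply_mem_wordSpan trivial self_mem_wordSpan m) a]
    congr 2
    simp only [Pi.add_apply, nsmul_eq_mul, Equiv.swap_apply_def]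
    split_ifs <;> simp_all
  -- The bracket of `E a b` with `E j i` is zero or, up to sign, again a raising operator other than
  -- `E i j`, because no index lies strictly between `i` and `j`. Hence induction on `k` applies.
  have hs : ∀ k a b, a < b → ¬(a = i ∧ b = j) → E a b ((E j i ^ k) v) = 0 := by
    intro k
    induction k with
    | zero => intro a b hab _; exact hv.sing a b hab
    | succ k ih =>
      intro a b hab hn
      rw [pow_succ', Module.End.mul_apply, hv.rel.apply, ih a b hab hn, map_zero, zero_add]
      have hab' := Fin.lt_def.mp hab
      rw [sub_eq_zero]
      trans (0 : V)
      · split_ifs with h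
        · subst h
          exact ih a i (Fin.lt_def.mpr (by
            have : (a : ℕ) ≠ i := fun h => hn ⟨Fin.ext h, rfl⟩
            omega)) (fun h => hne h.2)
        · rfl
      · split_ifs with h
        · subst h
          exact (ih j b (Fin.lt_def.mpr (by
            have : (b : ℕ) ≠ j := fun h => hn ⟨rfl, Fin.ext h⟩
            omega)) (fun h => hne h.1.symm)).symm
        · rfl
  have hnil : (E j i ^ (m + 1)) v = 0 := hv.nil i j hij
  refine ⟨hv.rel.comp _, ?_, ?_, ?_⟩
  · intro a b hab
    have hab' := Fin.lt_def.mp hab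
    by_cases hc : a = i ∧ b = j
    · obtain ⟨rfl, rfl⟩ := hc
      rw [Equiv.swap_apply_left, Equiv.swap_apply_right, ← Module.End.mul_apply, ← pow_succ', hnil]
    · refine hs m _ _ ?_ ?_
      · rw [Fin.lt_def]
        simp only [Equiv.swap_apply_def]
        split_ifs <;> simp_all [Fin.ext_iff] <;> omega
      · rintro ⟨h1, h2⟩
        rw [Equiv.swap_apply_eq_iff, Equiv.swap_apply_left] at h1
        rw [Equiv.swap_apply_eq_iff, Equiv.swap_apply_right] at h2
        subst h1 h2
        omega
  · intro a
    simpa using hwt (Equiv.swap i j a)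
  · intro a b hab
    have hlab : 0 ≤ lam a - lam b := sub_nonneg.mpr (hlam (Fin.le_def.mpr (by omega)))
    by_cases hai : a = i
    · obtain rfl : b = j := Fin.ext (by rw [← hab, hai, hij])
      subst hai
      rw [Equiv.swap_apply_left, Equiv.swap_apply_right, ← hm]
      have hw : (E a a - E b b) v = (m : K) • v := by
        rw [LinearMap.sub_apply, hv.weight, hv.weight, ← sub_smul, ← Int.cast_sub, ← hmij,
          Int.cast_natCast]
      -- The reflected lowering operator is the old raising operator; `m` applications return to a
      -- multiple of `v`, and one more gives zero.
      obtain ⟨d, -, hd⟩ := sl2_raise_pow (hv.rel.e_f a b) (hv.rel.h_f hne) hmp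
        (hv.sing a b hlt) hw m 0 (by omega)
      rw [pow_succ', Module.End.mul_apply]
      rw [zero_add] at hd
      rw [hd, map_smul, pow_zero, Module.End.one_apply, hv.sing a b hlt, smul_zero]
    by_cases haj : a = j
    · subst haj
      have hbi : b ≠ i := fun h => by subst h; omega
      have hba : b ≠ a := fun h => by subst h; omega
      rw [Equiv.swap_apply_right, Equiv.swap_apply_of_ne_of_ne hbi hba]
      have hcomm : E b a * E a i - E a i * E b a = E b i := by
        simpa [hbi.symm] using hv.rel b a a i
      -- The reflected lowering operator `E b i` is a commutator of two simple lowering operators.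
      -- The sign puts the operator applied to `v` in the role of `x`; it is removed by parity at
      -- the end.
      have hcomm' : (-E a i) * E b a - E b a * (-E a i) = E b i := by
        rw [← hcomm]; noncomm_ring
      have h1 := heisenberg_nilpotent (p := p) (x := -E a i) (y := E b a) (a := m)
        (b := (lam a - lam b).toNat) hcomm' ?_ ?_ (v := v) ?_ (hv.nil a b hab)
      · rw [neg_pow, Module.End.mul_apply] at h1
        rcases Nat.even_or_odd m with he | ho
        · simpa [he.neg_one_pow] using h1
        · simpa [ho.neg_one_pow] using h1
      · exact (hv.rel.commute hbi.symm hne).neg_left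
      · have := hp i b; omega
      · rw [neg_pow, Module.End.mul_apply, hnil, map_zero]
    by_cases hbi : b = i
    · subst hbi
      rw [Equiv.swap_apply_left, Equiv.swap_apply_of_ne_of_ne hai haj]
      -- The neighbour on the other side: again a commutator of two simple lowering operators, here
      -- with the right sign.
      have hcomm : E j b * E b a - E b a * E j b = E j a := by
        simpa [Ne.symm haj, haj] using hv.rel j b b a
      refine heisenberg_nilpotent (p := p) hcomm ?_ ?_ hnil (hv.nil a b hab)
      · exact hv.rel.commute hne haj
      · have := hp a j; omega
    · have hbj : b ≠ j := fun h => hai (Fin.ext (by subst h; omega))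
      rw [Equiv.swap_apply_of_ne_of_ne hai haj, Equiv.swap_apply_of_ne_of_ne hbi hbj,
        ← Module.End.mul_apply,
        ((hv.rel.commute haj (Ne.symm hbi)).pow_pow _ _).eq, Module.End.mul_apply,
        hv.nil a b hab, map_zero]

/-- Raising `m` times undoes lowering `m` times up to a scalar that is nonzero because `m < p`, so
nothing is lost in passing to the reflected vector. -/
theorem IsWeylVector.mem_wordSpan_reflect (hv : IsWeylVector E lam v) (hlam : Antitone lam)
    (hp : ∀ a b, lam a - lam b + 1 < (p : ℤ)) {i j : Fin n} (hij : (i : ℕ) + 1 = j) :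
    v ∈ wordSpan (fun a b => E (Equiv.swap i j a) (Equiv.swap i j b)) (fun _ _ => True) lam
      ((E j i ^ (lam i - lam j).toNat) v) (lam ∘ Equiv.swap i j) := by
  have hlt : i < j := Fin.lt_def.mpr (by omega)
  have hne : i ≠ j := hlt.ne
  set m := (lam i - lam j).toNat with hm
  have hmij : (m : ℤ) = lam i - lam j := Int.toNat_of_nonneg (sub_nonneg.mpr (hlam hlt.le))
  have hmp : m < p := by have := hp i j; omega
  have hw : (E i i - E j j) v = (m : K) • v := by
    rw [LinearMap.sub_apply, hv.weight, hv.weight, ← sub_smul, ← Int.cast_sub, ← hmij,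
      Int.cast_natCast]
  obtain ⟨d, hd0, hd⟩ := sl2_raise_pow (hv.rel.e_f i j) (hv.rel.h_f hne) hmp
    (hv.sing i j hlt) hw m 0 (by omega)
  rw [zero_add, pow_zero, Module.End.one_apply] at hd
  have h1 := pow_apply_mem_wordSpan
    (E := fun a b => E (Equiv.swap i j a) (Equiv.swap i j b)) (S := fun _ _ => True)
    (lam := lam) (v := (E j i ^ m) v) (a := j) (b := i) trivial self_mem_wordSpan m
  simp only [Equiv.swap_apply_left, Equiv.swap_apply_right] at h1
  rw [hd] at h1
  have h2 : lam + m • root j i = lam ∘ Equiv.swap i j := by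
    ext a
    simp only [Pi.add_apply, nsmul_eq_mul, Equiv.swap_apply_def, Function.comp_apply]
    split_ifs <;> simp_all
  rw [h2] at h1
  simpa [smul_smul, inv_mul_cancel₀ hd0] using Submodule.smul_mem _ d⁻¹ h1

/-- Words may be rewritten, up to a permutation of the indices, as words in another vector. -/
theorem mem_wordSpan_of_mem (s : Equiv.Perm (Fin n)) {w : V}
    (hv : v ∈ wordSpan (fun a b => E (s a) (s b)) (fun _ _ => True) lam w (lam ∘ s))
    {μ : Fin n → ℤ} {x : V} (hx : x ∈ wordSpan E (fun _ _ => True) lam v μ) :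
    x ∈ wordSpan (fun a b => E (s a) (s b)) (fun _ _ => True) lam w (μ ∘ s) := by
  suffices h : ∀ μ y, Word E (fun _ _ => True) lam v μ y →
      y ∈ wordSpan (fun a b => E (s a) (s b)) (fun _ _ => True) lam w (μ ∘ s) from
    Submodule.span_le.mpr (fun y hy => h μ y hy) hx
  intro μ y hy
  induction hy with
  | base => exact hv
  | @step μ y a b _ _ ih =>
    have h1 := apply_mem_wordSpan (a := s.symm a) (b := s.symm b) trivial ih
    simp only [Equiv.apply_symm_apply] at h1
    have h2 : (μ + root a b) ∘ s = μ ∘ s + root (s.symm a) (s.symm b) := by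
      ext c
      simp [root, Pi.single_apply, Equiv.eq_symm_apply]
    rwa [h2]

/-- The extremal vectors: for each permutation there is a vector which has the same properties
as `v` for the permuted operators, and which generates `v`. -/
theorem IsWeylVector.exists_extremal [Fact p.Prime] (hv : IsWeylVector E lam v) (hlam : Antitone lam)
    (hp : ∀ a b, lam a - lam b + 1 < (p : ℤ)) (s : Equiv.Perm (Fin n)) :
    ∃ w : V, IsWeylVector (fun a b => E (s a) (s b)) lam w ∧
      v ∈ wordSpan (fun a b => E (s a) (s b)) (fun _ _ => True) lam w (lam ∘ s) := by
  cases n with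
  | zero =>
    obtain rfl : s = 1 := Subsingleton.elim _ _
    exact ⟨v, hv, self_mem_wordSpan⟩
  | succ n =>
    have hs : s ∈ Submonoid.closure
        (Set.range fun i : Fin n => Equiv.swap i.castSucc i.succ) := by
      rw [Equiv.Perm.mclosure_swap_castSucc_succ]
      trivial
    -- An adjacent transposition on the right of `s` is a simple reflection for the matrix units
    -- already permuted by `s`, so the one-step lemmas apply to the current vector `w`.
    induction hs using Submonoid.closure_induction_right with
    | one => exact ⟨v, hv, self_mem_wordSpan⟩
    | mul_right s _ t ht ih =>
      obtain ⟨k, rfl⟩ := ht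
      obtain ⟨w, hw, hvw⟩ := ih
      have hk : ((k.castSucc : Fin (n + 1)) : ℕ) + 1 = (k.succ : Fin (n + 1)) := by simp
      have h1 := hw.reflect hlam hp hk
      have h2 := mem_wordSpan_of_mem (E := fun a b => E (s a) (s b)) (lam := lam)
        (Equiv.swap k.castSucc k.succ) (hw.mem_wordSpan_reflect hlam hp hk) hvw
      exact ⟨_, h1, h2⟩

/-- The coordinates of the weights of a Weyl module lie between those of the highest weight. -/
theorem IsWeylVector.weight_bounds [Fact p.Prime] (hv : IsWeylVector E lam v) (hlam : Antitone lam)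
    (hp : ∀ a b, lam a - lam b + 1 < (p : ℤ)) {μ : Fin n → ℤ}
    (hμ : wordSpan E (fun _ _ => True) lam v μ ≠ ⊥) (i₀ i₁ : Fin n) (h₀ : ∀ i, i₀ ≤ i)
    (h₁ : ∀ i, i ≤ i₁) (i : Fin n) : μ i ∈ Set.Icc (lam i₁) (lam i₀) := by
  -- Seen from the extremal vector for `s`, a vector of weight `μ` has weight `μ ∘ s` and is reached
  -- by lowering alone.
  have key : ∀ s : Equiv.Perm (Fin n), ∀ φ : (Fin n → ℤ) →+ ℤ,
      (∀ a b : Fin n, b < a → 0 ≤ φ (root a b)) → φ lam ≤ φ (μ ∘ s) := by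
    intro s φ hφ
    obtain ⟨w, hw, hvw⟩ := hv.exists_extremal hlam hp s
    by_contra! hlt
    refine hμ (eq_bot_iff.mpr fun x hx => ?_)
    have h1 := mem_wordSpan_lower hw.rel hw.sing hw.weight (mem_wordSpan_of_mem s hvw hx)
    rwa [wordSpan_lower_eq_bot φ hφ hlt] at h1
  constructor
  -- Lowering never decreases the last coordinate nor increases the first. The transposition moves
  -- coordinate `i` into the extreme position.
  · have h := key (Equiv.swap i₁ i) (Pi.evalAddMonoidHom _ i₁) (fun a b hab => by
      have hb : b ≠ i₁ := ((hab.trans_le (h₁ a))).ne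
      simp only [Pi.evalAddMonoidHom_apply, root, Pi.sub_apply, Pi.single_apply,
        if_neg hb.symm]
      split_ifs <;> simp)
    simpa using h
  · have h := key (Equiv.swap i₀ i) (-Pi.evalAddMonoidHom _ i₀) (fun a b hab => by
      have ha : a ≠ i₀ := ((h₀ b).trans_lt hab).ne'
      simp only [AddMonoidHom.neg_apply, Pi.evalAddMonoidHom_apply, root, Pi.sub_apply,
        Pi.single_apply, if_neg ha.symm]
      split_ifs <;> simp)
    simpa using h

end GlRep

/-! ### Central elements of `gl_n` and their eigenvalues on singular vectors. -/

namespace GlRep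

section Centre

variable {K V : Type*} [Field K] [AddCommGroup V] [Module K V] {n : ℕ}

/-- The entries of the powers of the matrix `(E i j)` with operator entries. -/
def matrixPow (E : Fin n → Fin n → Module.End K V) : ℕ → Fin n → Fin n → Module.End K V
  | 0, i, j => if i = j then 1 else 0
  | k + 1, i, j => ∑ a, E i a * matrixPow E k a j

variable {E : Fin n → Fin n → Module.End K V}

/-- The entries of a matrix power transform under brackets like the matrix units themselves. In the
Leibniz expansion the two inner terms, from `x = a` and `x = b`, cancel. -/
theorem IsMatrixUnits.matrixPow_comm (hE : IsMatrixUnits E) (k : ℕ) (a b c d : Fin n) :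
    E a b * matrixPow E k c d - matrixPow E k c d * E a b =
      (if b = c then matrixPow E k a d else 0) - (if d = a then matrixPow E k c b else 0) := by
  induction k generalizing c d with
  | zero =>
    have h1 : E a b * matrixPow E 0 c d - matrixPow E 0 c d * E a b = 0 := by
      simp only [matrixPow]
      split_ifs <;> simp
    rw [h1]
    simp only [matrixPow]
    by_cases hb : b = c <;> by_cases ha : d = a
    · simp [hb, ha]
    · simp [hb, ha, Ne.symm ha]
    · simp [hb, ha, Ne.symm hb]
    · simp [hb, ha]
  | succ k ih =>
    have hterm : ∀ x, E a b * (E c x * matrixPow E k x d) - E c x * matrixPow E k x d * E a b =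
        (if b = c then E a x * matrixPow E k x d else 0) -
          (if x = a then E c b * matrixPow E k x d else 0) +
        ((if b = x then E c x * matrixPow E k a d else 0) -
          (if d = a then E c x * matrixPow E k x b else 0)) := by
      intro x
      have h1 : E a b * (E c x * matrixPow E k x d) - E c x * matrixPow E k x d * E a b =
          (E a b * E c x - E c x * E a b) * matrixPow E k x d +
            E c x * (E a b * matrixPow E k x d - matrixPow E k x d * E a b) := by
        noncomm_ring
      rw [h1, hE, ih, sub_mul, mul_sub]
      simp only [ite_mul, mul_ite, zero_mul, mul_zero]
    simp only [matrixPow, Finset.mul_sum, Finset.sum_mul]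
    rw [← Finset.sum_sub_distrib, Finset.sum_congr rfl fun x _ => hterm x]
    simp only [Finset.sum_add_distrib, Finset.sum_sub_distrib, Finset.sum_ite_eq,
      Finset.sum_ite_eq', Finset.mem_univ, if_true]
    split_ifs <;> (try rw [Finset.sum_const_zero]) <;> abel

theorem IsMatrixUnits.commute_trace (hE : IsMatrixUnits E) (k : ℕ) (a b : Fin n) :
    Commute (E a b) (∑ i, matrixPow E k i i) := by
  rw [commute_iff_lie_eq, Ring.lie_def, Finset.mul_sum, Finset.sum_mul, ← Finset.sum_sub_distrib,
    Finset.sum_congr rfl fun i _ => hE.matrixPow_comm k a b i i]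
  simp

/-- The eigenvalues of the diagonal entries of the powers of `(E i j)` on a highest weight vector
of weight `c`, in terms of `m j = c j + (n - 1 - j)`. -/
def diagEigenvalue (m : Fin n → K) : ℕ → Fin n → K
  | 0, _ => 1
  | k + 1, j => m j * diagEigenvalue m k j - ∑ a ∈ Finset.Ioi j, diagEigenvalue m k a

/-- Expand the `(j, j)` entry as a sum over `a`. Terms with `a < j` vanish, and `a = j` gives `c j`.
For `a > j`, moving the raising operator onto `w` leaves the difference of the `j`-th and `a`-th
diagonal entries. The `n - 1 - j` indices above `j` produce the `ρ`-shift. -/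
theorem IsMatrixUnits.matrixPow_apply (hE : IsMatrixUnits E) {c : Fin n → K} {w : V}
    (hs : ∀ i j, i < j → E i j w = 0) (hw : ∀ i, E i i w = c i • w) (k : ℕ) :
    (∀ i j, i < j → matrixPow E k i j w = 0) ∧
    ∀ j, matrixPow E k j j w =
      diagEigenvalue (fun i => c i + ((n - 1 - i : ℕ) : K)) k j • w := by
  induction k with
  | zero =>
    refine ⟨fun i j hij => ?_, fun j => ?_⟩
    · simp [matrixPow, hij.ne]
    · simp [matrixPow, diagEigenvalue]
  | succ k ih =>
    obtain ⟨ih1, ih2⟩ := ih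
    have hcomm : ∀ i a j, E i a (matrixPow E k a j w) = matrixPow E k a j (E i a w) +
        (matrixPow E k i j w - if j = i then matrixPow E k a a w else 0) := by
      intro i a j
      have h := LinearMap.congr_fun (hE.matrixPow_comm k i a a j) w
      simp only [LinearMap.sub_apply, Module.End.mul_apply, if_true] at h
      rw [eq_add_of_sub_eq' h]
      congr 2
      split_ifs <;> rfl
    refine ⟨fun i j hij => ?_, fun j => ?_⟩
    · simp only [matrixPow, LinearMap.sum_apply, Module.End.mul_apply]
      refine Finset.sum_eq_zero fun a _ => ?_
      rcases lt_trichotomy a j with h | h | h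
      · rw [ih1 a j h, map_zero]
      · subst h
        rw [ih2, map_smul, hs i a hij, smul_zero]
      · rw [hcomm, hs i a (hij.trans h), ih1 i j hij, if_neg hij.ne']
        simp
    · simp only [matrixPow, LinearMap.sum_apply, Module.End.mul_apply, diagEigenvalue]
      have hlt : ∀ a, a < j → E j a (matrixPow E k a j w) = 0 := fun a h => by
        rw [ih1 a j h, map_zero]
      have hgt : ∀ a ∈ Finset.Ioi j, E j a (matrixPow E k a j w) =
          matrixPow E k j j w - matrixPow E k a a w := fun a h => by
        rw [hcomm, hs j a (Finset.mem_Ioi.mp h)]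
        simp
      have hsplit : ∑ a, E j a (matrixPow E k a j w) =
          E j j (matrixPow E k j j w) + ∑ a ∈ Finset.Ioi j, E j a (matrixPow E k a j w) := by
        rw [← Finset.sum_insert (f := fun a => E j a (matrixPow E k a j w)) Finset.notMem_Ioi_self]
        symm
        refine Finset.sum_subset (Finset.subset_univ _) fun a _ ha => hlt a ?_
        simp only [Finset.mem_insert, Finset.mem_Ioi, not_or, not_lt] at ha
        exact lt_of_le_of_ne ha.2 ha.1
      rw [hsplit, Finset.sum_congr rfl hgt, Finset.sum_sub_distrib, Finset.sum_const, Fin.card_Ioi,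
        ih2 j, map_smul, hw j, Finset.sum_congr rfl fun a _ => ih2 a, ← Finset.sum_smul,
        sub_smul, ← Nat.cast_smul_eq_nsmul K]
      module

end Centre

/-! ### Recovering the shifted weight from the central character. -/

section Eigenvalues

-- With `G_j` the generating series of the eigenvalues, the recursion reads `(1 - m_j X) G_j = 1 - X
-- ∑_{a > j} G_a`. So adjoining `j` to the indices above it multiplies `1 - X ∑ G_a` by `(1 - (m_j +
-- 1) X) / (1 - m_j X)`, and the product telescopes over upward closed sets.
open PowerSeries in
theorem prod_mul_one_sub_sum {K : Type*} [Field K] {n : ℕ} (m : Fin n → K) :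
    (∏ j, (1 - C (m j) * X)) *
        (1 - X * ∑ j, PowerSeries.mk fun k => diagEigenvalue m k j) =
      ∏ j, (1 - C (m j + 1) * X) := by
  have hrec : ∀ j, (PowerSeries.mk fun k => diagEigenvalue m k j) =
      1 + X * (C (m j) * (PowerSeries.mk fun k => diagEigenvalue m k j) -
        ∑ a ∈ Finset.Ioi j, PowerSeries.mk fun k => diagEigenvalue m k a) := by
    intro j
    ext k
    cases k with
    | zero => simp [diagEigenvalue]
    | succ k =>
      rw [map_add, coeff_succ_X_mul, map_sub, coeff_C_mul, map_sum]
      simp [diagEigenvalue, coeff_one]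
  have key : ∀ s : Finset (Fin n), (∀ j ∈ s, Finset.Ioi j ⊆ s) →
      (∏ j ∈ s, (1 - C (m j) * X)) *
          (1 - X * ∑ j ∈ s, PowerSeries.mk fun k => diagEigenvalue m k j) =
        ∏ j ∈ s, (1 - C (m j + 1) * X) := by
    intro s
    induction s using Finset.induction_on_min with
    | empty => simp
    | insert a s ha ih =>
      intro hs
      have has : a ∉ s := fun h => lt_irrefl _ (ha a h)
      have hIoi : Finset.Ioi a = s := by
        ext b
        constructor
        · intro hb
          have := hs a (Finset.mem_insert_self a s) hb
          rcases Finset.mem_insert.mp this with rfl | h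
          · simp at hb
          · exact h
        · exact fun hb => Finset.mem_Ioi.mpr (ha b hb)
      have ih' := ih fun j hj b hb => by
        have := hs j (Finset.mem_insert_of_mem hj) hb
        rcases Finset.mem_insert.mp this with rfl | h
        · exact absurd (Finset.mem_Ioi.mp hb) (ha j hj).not_gt
        · exact h
      have hr := hrec a
      rw [hIoi] at hr
      rw [Finset.prod_insert has, Finset.prod_insert has, Finset.sum_insert has, ← ih', map_add,
        map_one]
      linear_combination (-(X : K⟦X⟧) * ∏ j ∈ s, (1 - C (m j) * X)) * hr
  exact key Finset.univ fun _ _ => Finset.subset_univ _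

variable {K : Type*} [Field K] {n : ℕ} {m l : Fin n → K}

theorem prod_X_sub_C_eq_of_sum_diagEigenvalue_eq [Infinite K]
    (h : ∀ k, ∑ j, diagEigenvalue m k j = ∑ j, diagEigenvalue l k j) :
    (∏ j, (Polynomial.X - Polynomial.C (m j))) * ∏ j, (Polynomial.X - Polynomial.C (l j + 1)) =
    (∏ j, (Polynomial.X - Polynomial.C (l j))) *
      ∏ j, (Polynomial.X - Polynomial.C (m j + 1)) := by
  have hsum : (∑ j, PowerSeries.mk fun k => diagEigenvalue m k j) =
      ∑ j, PowerSeries.mk fun k => diagEigenvalue l k j := by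
    ext k
    simpa using h k
  have hm := prod_mul_one_sub_sum m
  rw [hsum] at hm
  have hl := prod_mul_one_sub_sum l
  have hps : (∏ j, (1 - PowerSeries.C (m j) * PowerSeries.X)) *
      ∏ j, (1 - PowerSeries.C (l j + 1) * PowerSeries.X) =
      (∏ j, (1 - PowerSeries.C (l j) * PowerSeries.X)) *
      ∏ j, (1 - PowerSeries.C (m j + 1) * PowerSeries.X) := by
    rw [← hm, ← hl]
    ring
  have hpoly : (∏ j, (1 - Polynomial.C (m j) * Polynomial.X)) *
      ∏ j, (1 - Polynomial.C (l j + 1) * Polynomial.X) =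
      (∏ j, (1 - Polynomial.C (l j) * Polynomial.X)) *
      ∏ j, (1 - Polynomial.C (m j + 1) * Polynomial.X) := by
    have hcoe : ∀ c : Fin n → K, ((∏ j, (1 - Polynomial.C (c j) * Polynomial.X) :
        Polynomial K) : PowerSeries K) = ∏ j, (1 - PowerSeries.C (c j) * PowerSeries.X) := by
      intro c
      rw [← Polynomial.coeToPowerSeries.ringHom_apply, map_prod]
      simp
    rw [← Polynomial.coe_inj, Polynomial.coe_mul, Polynomial.coe_mul, hcoe, hcoe, hcoe, hcoe, hps]
  -- Pass to reversed polynomials: evaluate at `u⁻¹` and multiply by powers of `u`. Since `K` is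
  -- infinite, agreement at all `u ≠ 0` is enough.
  refine Polynomial.eq_of_infinite_eval_eq _ _
    (Set.Infinite.mono ?_ (Set.finite_singleton (0 : K)).infinite_compl)
  intro u hu
  have hu : u ≠ 0 := hu
  have hev := congrArg (Polynomial.eval u⁻¹) hpoly
  have hscale : ∀ c : Fin n → K, ∏ j, (u - c j) = u ^ n * ∏ j, (1 - c j * u⁻¹) := by
    intro c
    rw [← Fin.prod_const n u, ← Finset.prod_mul_distrib]
    refine Finset.prod_congr rfl fun j _ => ?_
    field_simp
  simp only [Polynomial.eval_mul, Polynomial.eval_prod, Polynomial.eval_sub, Polynomial.eval_one,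
    Polynomial.eval_C, Polynomial.eval_X] at hev
  simp only [Set.mem_ofPred_eq, Polynomial.eval_mul, Polynomial.eval_prod, Polynomial.eval_sub,
    Polynomial.eval_C, Polynomial.eval_X, hscale]
  linear_combination u ^ n * u ^ n * hev

/-- The central character determines the residues `m j`, as soon as one residue is avoided. -/
theorem mem_range_of_sum_diagEigenvalue_eq [Infinite K]
    (h : ∀ k, ∑ j, diagEigenvalue m k j = ∑ j, diagEigenvalue l k j) {x : K}
    (hm : x ∉ Set.range m) (hl : x ∉ Set.range l) (t : ℕ) (ht : x + t ∈ Set.range m) :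
    x + t ∈ Set.range l := by
  classical
  have hpoly := prod_X_sub_C_eq_of_sum_diagEigenvalue_eq h
  set M : Multiset K := Finset.univ.val.map m with hM
  set N : Multiset K := Finset.univ.val.map l with hN
  have hms : M + N.map (· + 1) = N + M.map (· + 1) := by
    have hprod : ∀ c d : Fin n → K, (∏ j, (Polynomial.X - Polynomial.C (c j))) *
        ∏ j, (Polynomial.X - Polynomial.C (d j + 1)) =
        ((Finset.univ.val.map c + (Finset.univ.val.map d).map (· + 1)).map
          fun a => Polynomial.X - Polynomial.C a).prod := by
      intro c d
      rw [Multiset.map_add, Multiset.prod_add, Multiset.map_map, Multiset.map_map,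
        Multiset.map_map]
      rfl
    rw [hprod, hprod] at hpoly
    rw [← Polynomial.roots_multiset_prod_X_sub_C (M + N.map (· + 1)), hpoly,
      Polynomial.roots_multiset_prod_X_sub_C]
  -- The identity of multisets says that the difference of multiplicities is invariant under
  -- translation by `1`. In characteristic `p` it could still be a nonzero constant on a coset of
  -- the prime field; the avoided residue `x` makes it zero on this coset.
  have hcount : ∀ t : ℕ, M.count (x + t) = N.count (x + t) := by
    intro t
    induction t with
    | zero =>
      rw [Nat.cast_zero, add_zero, Multiset.count_eq_zero_of_notMem,
        Multiset.count_eq_zero_of_notMem]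
      · simpa [hN] using hl
      · simpa [hM] using hm
    | succ t ih =>
      have h1 := congrArg (Multiset.count (x + t + 1)) hms
      rw [Multiset.count_add, Multiset.count_add,
        Multiset.count_map_eq_count' (· + (1 : K)) N (add_left_injective 1),
        Multiset.count_map_eq_count' (· + (1 : K)) M (add_left_injective 1), ih] at h1
      rw [Nat.cast_succ, ← add_assoc]
      exact Nat.add_right_cancel h1
  have h1 : x + t ∈ M := by simpa [hM] using ht
  rw [← Multiset.count_pos, hcount, Multiset.count_pos] at h1
  simpa [hN] using h1

end Eigenvalues

end GlRep

/-! ### Singular vectors and irreducibility in the lowest alcove. -/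

namespace GlRep

theorem int_eq_of_cast_eq {K : Type*} [Field K] {p : ℕ} [CharP K p] {a b : ℤ}
    (h : (a : K) = b) (h1 : a - b < p) (h2 : b - a < p) : a = b := by
  have hdvd : (p : ℤ) ∣ a - b := by
    rw [← CharP.intCast_eq_zero_iff K p, Int.cast_sub, h, sub_self]
  have := Int.eq_zero_of_abs_lt_dvd hdvd (abs_lt.mpr ⟨by linarith, h1⟩)
  linarith

/-- If `a` and `b` are strictly decreasing and all values of `a` are values of `b`, then
`a = b`. -/
theorem strictAnti_eq_of_mem_range {n : ℕ} {a b : Fin n → ℤ} (ha : StrictAnti a)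
    (hb : StrictAnti b) (h : ∀ j, ∃ i, b i = a j) : a = b := by
  choose φ hφ using h
  have hmono : StrictMono φ := fun j k hjk => by
    have h1 := ha hjk
    rw [← hφ, ← hφ] at h1
    exact hb.lt_iff_gt.mp h1
  funext j
  rw [← hφ, le_antisymm hmono.apply_le hmono.le_apply]

/-- A submodule stable under diagonal operators contains the weight components of its elements. -/
theorem mem_of_add_sum_mem {K V ι α : Type*} [Field K] [AddCommGroup V] [Module K V]
    {D : ι → Module.End K V} {N : Submodule K V} (hN : ∀ i, ∀ x ∈ N, D i x ∈ N)
    (wt : α → ι → K) {μ : α} {s : Finset α} (hs : ∀ κ ∈ s, ∃ i, wt μ i ≠ wt κ i) {x : V}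
    {u : α → V} (hx : ∀ i, D i x = wt μ i • x) (hu : ∀ κ ∈ s, ∀ i, D i (u κ) = wt κ i • u κ)
    (h : x + ∑ κ ∈ s, u κ ∈ N) : x ∈ N := by
  classical
  induction s using Finset.induction_on generalizing x u with
  | empty => simpa using h
  | insert κ s hκ ih =>
    obtain ⟨i, hi⟩ := hs κ (Finset.mem_insert_self κ s)
    -- Applying `D i - wt κ i` removes the component `κ` and multiplies `x` by a nonzero scalar.
    have h1 : D i (x + ∑ κ ∈ insert κ s, u κ) - wt κ i • (x + ∑ κ ∈ insert κ s, u κ) =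
        (wt μ i - wt κ i) • x + ∑ ν ∈ s, (wt ν i - wt κ i) • u ν := by
      rw [Finset.sum_insert hκ, map_add, map_add, hx, hu κ (Finset.mem_insert_self κ s), map_sum,
        Finset.sum_congr rfl fun ν hν => hu ν (Finset.mem_insert_of_mem hν) i, sub_smul,
        Finset.sum_congr rfl fun ν _ => sub_smul (wt ν i) (wt κ i) (u ν), Finset.sum_sub_distrib,
        ← Finset.smul_sum, smul_add, smul_add]
      abel
    have h2 : (wt μ i - wt κ i) • x ∈ N := by
      refine ih (u := fun ν => (wt ν i - wt κ i) • u ν)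
        (fun ν hν => hs ν (Finset.mem_insert_of_mem hν)) ?_ ?_ ?_
      · intro j
        rw [map_smul, hx, smul_comm]
      · intro ν hν j
        rw [map_smul, hu ν (Finset.mem_insert_of_mem hν), smul_comm]
      · rw [← h1]
        exact sub_mem (hN i _ h) (N.smul_mem _ h)
    exact (N.smul_mem_iff (sub_ne_zero.mpr hi)).mp h2

variable {K V : Type*} [Field K] [AddCommGroup V] [Module K V] {n : ℕ}
variable {E : Fin n → Fin n → Module.End K V} {lam : Fin n → ℤ} {v : V}
variable {p : ℕ} [CharP K p]

/-- A singular vector which generates an integrable string for every root has dominant weight. -/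
theorem antitone_of_singular (hE : IsMatrixUnits E) (hw : ∀ i, E i i v = (lam i : K) • v)
    {A B : ℤ} (hAB : B - A + 1 < p)
    (hbd : ∀ ν, wordSpan E (fun _ _ => True) lam v ν ≠ ⊥ → ∀ i, ν i ∈ Set.Icc A B)
    {μ : Fin n → ℤ} {w : V} (hwμ : w ∈ wordSpan E (fun _ _ => True) lam v μ) (hw0 : w ≠ 0)
    (hs : ∀ i j, i < j → E i j w = 0) : Antitone μ := by
  classical
  intro i j hij
  rcases hij.eq_or_lt with rfl | hij
  · exact le_rfl
  by_contra! hlt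
  have hne := hij.ne
  have hμ := hbd μ (fun h => hw0 (by rw [h] at hwμ; exact (Submodule.mem_bot K).mp hwμ))
  -- Each lowering subtracts `1` from coordinate `i`, which cannot drop below `A`, so the string
  -- through `w` is finite.
  have hpow : ∀ k : ℕ, (E j i ^ k) w ≠ 0 → (k : ℤ) ≤ μ i - A := by
    intro k hk
    have h1 := pow_apply_mem_wordSpan (a := j) (b := i) trivial hwμ k
    have h2 := (hbd _ (fun h => hk (by rw [h] at h1; exact (Submodule.mem_bot K).mp h1)) i).1
    simp [root, hne] at h2
    linarith
  have hex : ∃ k : ℕ, (E j i ^ k) w = 0 := by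
    by_contra! h
    have := hpow _ (h (μ i - A + 1).toNat)
    omega
  obtain ⟨k, hk⟩ : ∃ k, Nat.find hex = k + 1 := by
    refine Nat.exists_eq_succ_of_ne_zero fun h0 => hw0 ?_
    have := Nat.find_spec hex
    rwa [h0] at this
  have hk0 : (E j i ^ (k + 1)) w = 0 := hk ▸ Nat.find_spec hex
  have hk1 : (E j i ^ k) w ≠ 0 := Nat.find_min hex (by omega)
  have hkA := hpow k hk1
  have hww : (E i i - E j j) w = ((μ i - μ j : ℤ) : K) • w := by
    rw [LinearMap.sub_apply, apply_diag_of_mem_wordSpan hE hw hwμ,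
      apply_diag_of_mem_wordSpan hE hw hwμ, ← sub_smul, Int.cast_sub]
  have hr := sl2_raise (hE.e_f i j) (hE.h_f hne) (hs i j hij) hww k
  rw [hk0, map_zero, eq_comm, smul_eq_zero] at hr
  have hr := hr.resolve_right hk1
  have hμi := hμ i
  have hμj := hμ j
  simp only [Set.mem_Icc] at hμi hμj
  -- At the end of the string `(k + 1)(μ i - μ j - k) = 0` in `K`. The bounds turn this into an
  -- equality of integers: the first factor cannot vanish, and the second gives `μ i - μ j = k ≥ 0`.
  rcases mul_eq_zero.mp hr with h | h
  · have := int_eq_of_cast_eq (p := p) (a := k + 1) (b := 0) (K := K) (by push_cast; exact h)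
      (by linarith) (by linarith)
    omega
  · have := int_eq_of_cast_eq (p := p) (a := μ i - μ j) (b := k) (K := K)
      (by push_cast; push_cast at h; exact sub_eq_zero.mp h) (by linarith) (by linarith)
    omega

/-- A nonzero singular vector in a module generated by a highest weight vector has the same
central character. -/
theorem sum_diagEigenvalue_eq (hE : IsMatrixUnits E) (hsing : ∀ i j, i < j → E i j v = 0)
    (hwt : ∀ i, E i i v = (lam i : K) • v)
    (hgen : ∀ N : Submodule K V, v ∈ N → (∀ a b, ∀ x ∈ N, E a b x ∈ N) → N = ⊤)
    {μ : Fin n → ℤ} {w : V} (hw0 : w ≠ 0) (hs : ∀ i j, i < j → E i j w = 0)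
    (hw : ∀ i, E i i w = (μ i : K) • w) (k : ℕ) :
    ∑ j, diagEigenvalue (fun i => (μ i : K) + ((n - 1 - i : ℕ) : K)) k j =
      ∑ j, diagEigenvalue (fun i => (lam i : K) + ((n - 1 - i : ℕ) : K)) k j := by
  have htr : ∀ (ν : Fin n → ℤ) (y : V), (∀ i j, i < j → E i j y = 0) →
      (∀ i, E i i y = (ν i : K) • y) → (∑ i, matrixPow E k i i) y =
        (∑ j, diagEigenvalue (fun i => (ν i : K) + ((n - 1 - i : ℕ) : K)) k j) • y := by
    intro ν y h1 h2
    rw [LinearMap.sum_apply, Finset.sum_smul]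
    exact Finset.sum_congr rfl fun i _ => (hE.matrixPow_apply h1 h2 k).2 i
  set c := ∑ j, diagEigenvalue (fun i => (lam i : K) + ((n - 1 - i : ℕ) : K)) k j with hc
  -- The eigenspace of a central operator is a submodule; it contains the generator `v`, hence
  -- everything.
  have htop := hgen (LinearMap.ker ((∑ i, matrixPow E k i i) - c • LinearMap.id))
    (by simp [LinearMap.mem_ker, htr lam v hsing hwt, ← hc]) (by
      intro a b x hx
      simp only [LinearMap.mem_ker, LinearMap.sub_apply, LinearMap.smul_apply, LinearMap.id_apply,
        sub_eq_zero] at hx ⊢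
      rw [← Module.End.mul_apply, ← (hE.commute_trace k a b).eq, Module.End.mul_apply, hx,
        map_smul])
  have hmem : w ∈ LinearMap.ker ((∑ i, matrixPow E k i i) - c • LinearMap.id) := by
    rw [htop]; trivial
  simp only [LinearMap.mem_ker, LinearMap.sub_apply, LinearMap.smul_apply, LinearMap.id_apply,
    htr μ w hs hw, ← sub_smul] at hmem
  exact sub_eq_zero.mp ((smul_eq_zero.mp hmem).resolve_right hw0)

/-- A dominant weight in the lowest alcove is determined by its central character modulo `p`. -/
theorem eq_of_sum_diagEigenvalue_eq [Infinite K] {A B : ℤ} (hAB : B - A + n < p)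
    {μ : Fin n → ℤ} (hμ : Antitone μ) (hlam : Antitone lam) (hμb : ∀ i, μ i ∈ Set.Icc A B)
    (hlb : ∀ i, lam i ∈ Set.Icc A B)
    (h : ∀ k, ∑ j, diagEigenvalue (fun i => (μ i : K) + ((n - 1 - i : ℕ) : K)) k j =
      ∑ j, diagEigenvalue (fun i => (lam i : K) + ((n - 1 - i : ℕ) : K)) k j) : μ = lam := by
  have hanti : ∀ ν : Fin n → ℤ, Antitone ν → StrictAnti fun i => ν i + ((n - 1 - i : ℕ) : ℤ) := by
    intro ν hν i j hij
    have h1 := hν hij.le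
    have h2 := Fin.lt_def.mp hij
    have h3 := j.2
    change ν j + ((n - 1 - j : ℕ) : ℤ) < ν i + ((n - 1 - i : ℕ) : ℤ)
    omega
  -- All shifted coordinates lie in `[A, B + n - 1]`, so `B - A + n < p` leaves the residue of `A -
  -- 1` free. This is where the full bound on `p` is used.
  have hx : ∀ ν : Fin n → ℤ, (∀ i, ν i ∈ Set.Icc A B) →
      ((A - 1 : ℤ) : K) ∉ Set.range fun i => (ν i : K) + ((n - 1 - i : ℕ) : K) := by
    rintro ν hν ⟨i, hi⟩
    have h1 := hν i
    have h2 := i.2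
    simp only [Set.mem_Icc] at h1
    have := int_eq_of_cast_eq (K := K) (p := p) (a := ν i + ((n - 1 - i : ℕ) : ℤ)) (b := A - 1)
      (by rw [Int.cast_add, Int.cast_natCast]; exact hi) (by omega) (by omega)
    omega
  have heq := strictAnti_eq_of_mem_range (hanti μ hμ) (hanti lam hlam) (by
    intro j
    have h1 := hμb j
    have h2 := j.2
    simp only [Set.mem_Icc] at h1
    obtain ⟨t, ht⟩ : ∃ t : ℕ, (t : ℤ) = μ j + ((n - 1 - j : ℕ) : ℤ) - (A - 1) :=
      ⟨_, Int.toNat_of_nonneg (by omega)⟩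
    have hcast : ((A - 1 : ℤ) : K) + t = (μ j : K) + ((n - 1 - j : ℕ) : K) := by
      have := congrArg (Int.cast : ℤ → K) ht
      push_cast at this ⊢
      rw [this]
      ring
    obtain ⟨i, hi⟩ := mem_range_of_sum_diagEigenvalue_eq h (hx μ hμb) (hx lam hlb) t
      ⟨j, hcast.symm⟩
    refine ⟨i, ?_⟩
    have h3 := hlb i
    have h4 := i.2
    simp only [Set.mem_Icc] at h3
    refine int_eq_of_cast_eq (K := K) (p := p) ?_ (by omega) (by omega)
    rw [Int.cast_add, Int.cast_natCast, Int.cast_add, Int.cast_natCast, ← hcast]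
    exact hi)
  funext i
  have := congrFun heq i
  simpa using this

/-- A Weyl vector in the lowest alcove generates an irreducible module. -/
theorem IsWeylVector.eq_top [Infinite K] [Fact p.Prime] (hv : IsWeylVector E lam v)
    (hlam : Antitone lam) (i₀ i₁ : Fin n) (h₀ : ∀ i, i₀ ≤ i) (h₁ : ∀ i, i ≤ i₁)
    (hp : lam i₀ - lam i₁ + n < (p : ℤ))
    (hgen : ∀ N : Submodule K V, v ∈ N → (∀ a b, ∀ x ∈ N, E a b x ∈ N) → N = ⊤)
    {N : Submodule K V} (hN : ∀ a b, ∀ x ∈ N, E a b x ∈ N) (hne : N ≠ ⊥) : N = ⊤ := by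
  classical
  set W := wordSpan E (fun _ _ => True) lam v with hW
  have hn : 1 ≤ n := i₀.pos
  have hlb : ∀ i, lam i ∈ Set.Icc (lam i₁) (lam i₀) := fun i => ⟨hlam (h₁ i), hlam (h₀ i)⟩
  have hp' : ∀ a b, lam a - lam b + 1 < (p : ℤ) := fun a b => by
    have := (hlb a).2
    have := (hlb b).1
    omega
  have hbd : ∀ μ, W μ ≠ ⊥ → ∀ i, μ i ∈ Set.Icc (lam i₁) (lam i₀) := fun μ hμ =>
    hv.weight_bounds hlam hp' hμ i₀ i₁ h₀ h₁
  have hdiag : ∀ μ, ∀ x ∈ W μ, ∀ i, E i i x = (μ i : K) • x := fun μ x hx =>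
    apply_diag_of_mem_wordSpan hv.rel hv.weight hx
  set box : Finset (Fin n → ℤ) := Fintype.piFinset fun _ => Finset.Icc (lam i₁) (lam i₀)
    with hbox
  have hmem : ∀ μ, W μ ≠ ⊥ → μ ∈ box := fun μ hμ =>
    Fintype.mem_piFinset.mpr fun i => Finset.mem_Icc.mpr (hbd μ hμ i)
  have htop : ⨆ μ ∈ box, W μ = ⊤ := by
    have hstab : ⨆ μ, W μ = ⊤ := by
      refine hgen _ (Submodule.mem_iSup_of_mem lam self_mem_wordSpan) fun a b x hx => ?_
      have hle : ⨆ μ, W μ ≤ (⨆ μ, W μ).comap (E a b) := iSup_le fun μ y hy =>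
        Submodule.mem_iSup_of_mem _ (apply_mem_wordSpan (S := fun _ _ => True) trivial hy)
      exact hle hx
    rw [eq_top_iff, ← hstab]
    refine iSup_le fun μ => ?_
    by_cases hμ : W μ = ⊥
    · rw [hμ]
      exact bot_le
    · exact le_iSup₂_of_le μ (hmem μ hμ) le_rfl
  -- Distinct points of `box` have distinct residues mod `p`, so diagonal operators separate the
  -- components of an element of `N`.
  have hweight : ∃ μ ∈ box, N ⊓ W μ ≠ ⊥ := by
    obtain ⟨x, hxN, hx0⟩ := Submodule.exists_mem_ne_zero_of_ne_bot hne
    have hx : x ∈ ⨆ μ ∈ box, W μ := by rw [htop]; trivial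
    obtain ⟨u, hu⟩ := (Submodule.mem_iSup_finset_iff_exists_sum _ _).mp hx
    obtain ⟨μ, hμ, hμ0⟩ : ∃ μ ∈ box, (u μ : V) ≠ 0 := by
      by_contra! h
      exact hx0 (by rw [← hu, Finset.sum_eq_zero h])
    refine ⟨μ, hμ, fun hbot => hμ0 ?_⟩
    have hmemN : (u μ : V) ∈ N := by
      refine mem_of_add_sum_mem (D := fun i => E i i) (fun i x hx => hN i i x hx)
        (fun κ i => ((κ i : ℤ) : K)) (μ := μ) (s := box.erase μ) (u := fun κ => (u κ : V))
        ?_ (hdiag μ _ (u μ).2) (fun κ _ => hdiag κ _ (u κ).2) ?_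
      · intro κ hκ
        by_contra! h
        refine Finset.ne_of_mem_erase hκ (funext fun i => ?_)
        have h1 := Finset.mem_Icc.mp (Fintype.mem_piFinset.mp (Finset.mem_of_mem_erase hκ) i)
        have h2 := Finset.mem_Icc.mp (Fintype.mem_piFinset.mp hμ i)
        exact (int_eq_of_cast_eq (K := K) (p := p) (h i) (by omega) (by omega)).symm
      · rw [Finset.add_sum_erase box (fun κ => (u κ : V)) hμ, hu]
        exact hxN
    have : (u μ : V) ∈ N ⊓ W μ := ⟨hmemN, (u μ).2⟩
    rwa [hbot, Submodule.mem_bot] at this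
  -- Raising operators strictly decrease `depth`, so a weight vector of `N` of least depth is
  -- singular.
  obtain ⟨μ, hμ, hmin⟩ := Finset.exists_min_image (box.filter fun μ => N ⊓ W μ ≠ ⊥) depth (by
    obtain ⟨μ, h1, h2⟩ := hweight
    exact ⟨μ, Finset.mem_filter.mpr ⟨h1, h2⟩⟩)
  obtain ⟨hμbox, hμ⟩ := Finset.mem_filter.mp hμ
  obtain ⟨w, ⟨hwN, hwW⟩, hw0⟩ := Submodule.exists_mem_ne_zero_of_ne_bot hμ
  have hs : ∀ i j, i < j → E i j w = 0 := by
    intro i j hij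
    by_contra h
    have hWij : E i j w ∈ W (μ + root i j) :=
      apply_mem_wordSpan (S := fun _ _ => True) trivial hwW
    have hne' : N ⊓ W (μ + root i j) ≠ ⊥ := fun hbot => h (by
      have : E i j w ∈ N ⊓ W (μ + root i j) := ⟨hN i j w hwN, hWij⟩
      rwa [hbot, Submodule.mem_bot] at this)
    have h1 := hmin (μ + root i j) (Finset.mem_filter.mpr
      ⟨hmem _ (fun hbot => hne' (by rw [hbot, inf_bot_eq])), hne'⟩)
    rw [map_add, depth_root] at h1
    have := Fin.lt_def.mp hij
    omega
  have hμanti := antitone_of_singular hv.rel hv.weight (A := lam i₁) (B := lam i₀) (p := p)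
    (by omega) hbd hwW hw0 hs
  have hμb : ∀ i, μ i ∈ Set.Icc (lam i₁) (lam i₀) := fun i =>
    Finset.mem_Icc.mp (Fintype.mem_piFinset.mp hμbox i)
  have hμlam : μ = lam := eq_of_sum_diagEigenvalue_eq (K := K) hp hμanti hlam hμb hlb
    (sum_diagEigenvalue_eq hv.rel hv.sing hv.weight hgen hw0 hs (hdiag μ w hwW))
  subst hμlam
  obtain ⟨c, hc⟩ := Submodule.mem_span_singleton.mp
    (wordSpan_lower_self_le (mem_wordSpan_lower hv.rel hv.sing hv.weight hwW))
  have hc0 : c ≠ 0 := fun h => hw0 (by rw [← hc, h, zero_smul])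
  refine hgen N ?_ hN
  rw [← hc] at hwN
  exact (N.smul_mem_iff hc0).mp hwN

end GlRep

/-! ### A polynomial model with a nonzero Weyl vector. -/

noncomputable section

namespace GlRep

section Derivations

theorem derivation_prod {R A ι : Type*} [CommSemiring R] [CommRing A] [Algebra R A]
    [DecidableEq ι] (D : Derivation R A A) (s : Finset ι) (g : ι → A) :
    D (∏ i ∈ s, g i) = ∑ i ∈ s, ∏ j ∈ s, if j = i then D (g j) else g j := by
  induction s using Finset.induction_on with
  | empty => simp
  | insert a s ha ih =>
    rw [Finset.prod_insert ha, D.leibniz, ih, Finset.sum_insert ha, Finset.prod_insert ha,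
      if_pos rfl, smul_eq_mul, smul_eq_mul, Finset.mul_sum, add_comm]
    congr 1
    · rw [mul_comm]
      congr 1
      refine Finset.prod_congr rfl fun j hj => ?_
      rw [if_neg fun h : j = a => ha (h ▸ hj)]
    · refine Finset.sum_congr rfl fun i hi => ?_
      rw [Finset.prod_insert ha, if_neg fun h : a = i => ha (h ▸ hi)]

theorem derivation_det {R A ι : Type*} [CommRing R] [CommRing A] [Algebra R A]
    [DecidableEq ι] [Fintype ι] (D : Derivation R A A) (M : Matrix ι ι A) :
    D M.det = ∑ i, (M.updateCol i fun r => D (M r i)).det := by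
  simp only [Matrix.det_apply, map_sum]
  rw [Finset.sum_comm]
  refine Finset.sum_congr rfl fun σ _ => ?_
  rw [← Finset.smul_sum, Units.smul_def, map_zsmul, derivation_prod]
  congr 1
  refine Finset.sum_congr rfl fun i _ => Finset.prod_congr rfl fun j _ => ?_
  rw [Matrix.updateCol_apply]
  split_ifs with h
  · rw [h]
  · rfl

theorem derivation_prod_pow_of_eigen {R A ι : Type*} [CommRing R] [CommRing A] [Algebra R A]
    (D : Derivation R A A) (s : Finset ι) (y : ι → A) (c : ι → ℕ) (w : ι → R)
    (h : ∀ k ∈ s, D (y k) = w k • y k) :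
    D (∏ k ∈ s, y k ^ c k) = (∑ k ∈ s, (c k : R) * w k) • ∏ k ∈ s, y k ^ c k := by
  classical
  have hpow : ∀ k ∈ s, D (y k ^ c k) = ((c k : R) * w k) • y k ^ c k := by
    intro k hk
    rw [D.leibniz_pow, h k hk]
    cases hc : c k with
    | zero => simp
    | succ t =>
      rw [Nat.add_sub_cancel, smul_eq_mul, mul_smul_comm, ← pow_succ, mul_smul,
        Nat.cast_smul_eq_nsmul]
  induction s using Finset.induction_on with
  | empty => simp
  | insert a s ha ih =>
    rw [Finset.prod_insert ha, D.leibniz, ih (fun k hk => h k (Finset.mem_insert_of_mem hk))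
      (fun k hk => hpow k (Finset.mem_insert_of_mem hk)), hpow a (Finset.mem_insert_self a s),
      Finset.sum_insert ha, smul_eq_mul, smul_eq_mul, mul_smul_comm, mul_smul_comm, add_smul,
      add_comm, mul_comm (∏ k ∈ s, y k ^ c k)]

/-- Each application of `D` lowers the exponent of `y` by one, at the cost of a factor `D y` that
`D` kills. -/
theorem derivation_pow_eq_zero {R A : Type*} [CommRing R] [CommRing A] [Algebra R A]
    (D : Derivation R A A) {y : A} (hy : D (D y) = 0) (t s : ℕ) (hst : s < t) (q : A)
    (hq : D q = 0) : ((D : A →ₗ[R] A) ^ t) (y ^ s * q) = 0 := by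
  induction t generalizing s q with
  | zero => omega
  | succ t ih =>
    rw [pow_succ, Module.End.mul_apply]
    cases s with
    | zero => simp [hq]
    | succ s =>
      have h1 : (D : A →ₗ[R] A) (y ^ (s + 1) * q) = y ^ s * ((s + 1 : ℕ) • (D y * q)) := by
        rw [Derivation.coeFn_coe, D.leibniz, hq, smul_zero, zero_add, D.leibniz_pow]
        simp only [smul_eq_mul, nsmul_eq_mul, Nat.add_sub_cancel]
        ring
      rw [h1]
      refine ih s (by omega) _ ?_
      rw [map_nsmul, D.leibniz, hy, hq]
      simp

end Derivations

section Polynomials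

open MvPolynomial

variable {K : Type*} [Field K] {n : ℕ}

/-- The derivation of the polynomial ring in the entries of a matrix by which `x` in `gl_n` acts. -/
def polyDerivation (x : Matrix (Fin n) (Fin n) K) :
    Derivation K (MvPolynomial (Fin n × ℕ) K) (MvPolynomial (Fin n × ℕ) K) :=
  mkDerivation K fun q => ∑ a, x a q.1 • X (a, q.2)

theorem polyDerivation_X (x : Matrix (Fin n) (Fin n) K) (b : Fin n) (k : ℕ) :
    polyDerivation x (X (b, k)) = ∑ a, x a b • X (a, k) :=
  mkDerivation_X K _ _

theorem polyDerivation_single_X (a b c : Fin n) (k : ℕ) :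
    polyDerivation (Matrix.single a b (1 : K)) (X (c, k)) = if c = b then X (a, k) else 0 := by
  rw [polyDerivation_X]
  rw [Finset.sum_eq_single a]
  · by_cases h : c = b
    · simp [h]
    · simp [h, Ne.symm h]
  · intro d _ hd
    simp [Ne.symm hd]
  · simp

/-- The action of `gl_n` on the polynomial ring in the entries of a matrix, twisted by a multiple
of the trace. -/
def polyRep (c : K) :
    Matrix (Fin n) (Fin n) K →ₗ⁅K⁆ Module.End K (MvPolynomial (Fin n × ℕ) K) where
  toFun x := (polyDerivation x : _ →ₗ[K] _) + (c * x.trace) • 1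
  map_add' x y := by
    have h : polyDerivation (x + y) = polyDerivation x + polyDerivation y := by
      refine derivation_ext fun q => ?_
      rw [Derivation.add_apply, polyDerivation_X, polyDerivation_X, polyDerivation_X,
        ← Finset.sum_add_distrib]
      simp [add_smul]
    rw [h, Matrix.trace_add, mul_add, add_smul, Derivation.coe_add_linearMap]
    abel
  map_smul' r x := by
    have h : polyDerivation (r • x) = r • polyDerivation x := by
      refine derivation_ext fun q => ?_
      rw [Derivation.smul_apply, polyDerivation_X, polyDerivation_X, Finset.smul_sum]
      simp [mul_smul]
    rw [h, Matrix.trace_smul, Derivation.coe_smul_linearMap, RingHom.id_apply, smul_add, smul_smul,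
      smul_eq_mul, mul_left_comm]
  map_lie' := by
    intro x y
    have h : polyDerivation ⁅x, y⁆ = ⁅polyDerivation x, polyDerivation y⁆ := by
      refine derivation_ext fun q => ?_
      obtain ⟨b, k⟩ := q
      rw [Derivation.commutator_apply, polyDerivation_X, polyDerivation_X, polyDerivation_X,
        map_sum, map_sum]
      simp only [Derivation.map_smul, polyDerivation_X, Finset.smul_sum, smul_smul]
      rw [Finset.sum_comm, Finset.sum_comm (f := fun a d => (x a b * y d a) • _),
        ← Finset.sum_sub_distrib]
      refine Finset.sum_congr rfl fun a _ => ?_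
      rw [← Finset.sum_smul, ← Finset.sum_smul, ← sub_smul, Ring.lie_def, Matrix.sub_apply,
        Matrix.mul_apply, Matrix.mul_apply]
      simp only [mul_comm]
    have htr : Matrix.trace ⁅x, y⁆ = 0 := by
      rw [Ring.lie_def, Matrix.trace_sub, Matrix.trace_mul_comm, sub_self]
    rw [htr, mul_zero, zero_smul, add_zero, h, Ring.lie_def]
    refine LinearMap.ext fun q => ?_
    simp only [Derivation.coeFn_coe, Derivation.commutator_apply, LinearMap.sub_apply,
      Module.End.mul_apply, LinearMap.add_apply, LinearMap.smul_apply, Module.End.one_apply,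
      map_add, map_smul]
    module

/-- The leading principal minors, with `k + 1` rows and columns. -/
def minor (K : Type*) [Field K] (k : Fin n) : MvPolynomial (Fin n × ℕ) K :=
  (Matrix.of fun i j : Fin (k + 1) => X (Fin.castLE k.isLt j, (i : ℕ))).det

/-- Specialising the variables to the identity matrix gives the value `1`. -/
theorem minor_ne_zero (k : Fin n) : minor K k ≠ 0 := by
  intro h
  have h1 := congrArg (aeval fun q : Fin n × ℕ => if (q.1 : ℕ) = q.2 then (1 : K) else 0) h
  rw [minor, AlgHom.map_det, map_zero] at h1
  refine one_ne_zero (α := K) ?_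
  rw [← h1, ← Matrix.det_one (n := Fin (k + 1))]
  congr 1
  ext i j
  simp [Matrix.one_apply, Fin.ext_iff, eq_comm]

theorem polyDerivation_minor_of_lt {a b k : Fin n} (hk : k < b) :
    polyDerivation (Matrix.single a b (1 : K)) (minor K k) = 0 := by
  rw [minor, derivation_det]
  refine Finset.sum_eq_zero fun i _ => Matrix.det_eq_zero_of_column_eq_zero i fun r => ?_
  rw [Matrix.updateCol_self, Matrix.of_apply, polyDerivation_single_X, if_neg]
  intro h
  have h1 := Fin.lt_def.mp hk
  have h2 := congrArg Fin.val h
  have h3 := i.2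
  rw [Fin.val_castLE] at h2
  omega

theorem polyDerivation_minor_of_le {a b k : Fin n} (hk : b ≤ k) :
    polyDerivation (Matrix.single a b (1 : K)) (minor K k) =
      ((Matrix.of fun i j : Fin (k + 1) => X (Fin.castLE k.isLt j, (i : ℕ))).updateCol
        ⟨b, Nat.lt_succ_of_le hk⟩ fun r => X (a, (r : ℕ)) : Matrix _ _ (MvPolynomial _ K)).det := by
  rw [minor, derivation_det, Finset.sum_eq_single ⟨b, Nat.lt_succ_of_le hk⟩]
  · congr 2
    funext r
    rw [Matrix.of_apply, polyDerivation_single_X, if_pos]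
    rfl
  · intro i _ hi
    refine Matrix.det_eq_zero_of_column_eq_zero i fun r => ?_
    rw [Matrix.updateCol_self, Matrix.of_apply, polyDerivation_single_X, if_neg]
    intro h
    exact hi (Fin.ext (by simpa using congrArg Fin.val h))
  · simp

theorem polyDerivation_minor_diag {a k : Fin n} :
    polyDerivation (Matrix.single a a (1 : K)) (minor K k) =
      (if a ≤ k then (1 : K) else 0) • minor K k := by
  split_ifs with h
  · rw [polyDerivation_minor_of_le h, one_smul, minor]
    congr 1
    ext i j : 2
    rw [Matrix.updateCol_apply]
    split_ifs with hj
    · subst hj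
      rfl
    · rfl
  · rw [polyDerivation_minor_of_lt (not_le.mp h), zero_smul]

/-- The derivation replaces column `b` by column `a`: either column `b` is absent, or the result has
two equal columns. -/
theorem polyDerivation_minor_eq_zero {a b k : Fin n} (hab : a ≠ b) (h : b ≤ k → a ≤ k) :
    polyDerivation (Matrix.single a b (1 : K)) (minor K k) = 0 := by
  rcases lt_or_ge k b with hk | hk
  · exact polyDerivation_minor_of_lt hk
  · rw [polyDerivation_minor_of_le hk]
    have hne : (⟨b, Nat.lt_succ_of_le hk⟩ : Fin (k + 1)) ≠ ⟨a, Nat.lt_succ_of_le (h hk)⟩ :=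
      fun h => hab (Fin.ext (congrArg Fin.val h).symm)
    refine Matrix.det_zero_of_column_eq hne fun r => ?_
    rw [Matrix.updateCol_self, Matrix.updateCol_ne hne.symm]
    rfl

theorem polyDerivation_polyDerivation_minor {a b k : Fin n} (hab : a ≠ b) :
    polyDerivation (Matrix.single a b (1 : K))
      (polyDerivation (Matrix.single a b (1 : K)) (minor K k)) = 0 := by
  rcases lt_or_ge k b with hk | hk
  · rw [polyDerivation_minor_of_lt hk, map_zero]
  · rw [polyDerivation_minor_of_le hk, derivation_det]
    refine Finset.sum_eq_zero fun i _ => Matrix.det_eq_zero_of_column_eq_zero i fun r => ?_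
    rw [Matrix.updateCol_self, Matrix.updateCol_apply]
    split_ifs with h
    · rw [polyDerivation_single_X, if_neg hab]
    · rw [Matrix.of_apply, polyDerivation_single_X, if_neg]
      intro h'
      exact h (Fin.ext (by simpa using congrArg Fin.val h'))

/-- The exponents `λ_k - λ_{k+1}` of the minors, the last one being `0`. -/
def minorExponent (lam : Fin n → ℤ) (k : Fin n) : ℕ :=
  if h : (k : ℕ) + 1 < n then (lam k - lam ⟨k + 1, h⟩).toNat else 0

/-- The product of powers of minors of weight `lam`. -/
def minorProduct (K : Type*) [Field K] (lam : Fin n → ℤ) : MvPolynomial (Fin n × ℕ) K :=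
  ∏ k, minor K k ^ minorExponent lam k

theorem minorProduct_ne_zero (lam : Fin n → ℤ) : minorProduct K lam ≠ 0 :=
  Finset.prod_ne_zero_iff.mpr fun k _ => pow_ne_zero _ (minor_ne_zero k)

theorem sum_minorExponent {lam : Fin n → ℤ} (hlam : Antitone lam) (hn : 0 < n) (a : Fin n) :
    ∑ k, (if a ≤ k then (minorExponent lam k : ℤ) else 0) =
      lam a - lam ⟨n - 1, Nat.sub_lt hn one_pos⟩ := by
  -- Extending `lam` by its last value makes the final exponent `0` a difference like the others, so
  -- the sum telescopes.
  set Λ : ℕ → ℤ := fun t => lam ⟨min t (n - 1), by omega⟩ with hΛ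
  have h1 : ∀ k : Fin n, (minorExponent lam k : ℤ) = Λ k - Λ (k + 1) := by
    intro k
    have hk : (⟨min (k : ℕ) (n - 1), by omega⟩ : Fin n) = k := Fin.ext (by simp; omega)
    rw [minorExponent]
    split_ifs with h
    · have hk' : (⟨min ((k : ℕ) + 1) (n - 1), by omega⟩ : Fin n) = ⟨k + 1, h⟩ :=
        Fin.ext (by simp; omega)
      rw [hΛ]
      simp only [hk, hk']
      exact Int.toNat_of_nonneg (sub_nonneg.mpr (hlam (Fin.le_def.mpr (Nat.le_succ _))))
    · have hk' : (⟨min ((k : ℕ) + 1) (n - 1), by omega⟩ : Fin n) = k :=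
        Fin.ext (by simp; omega)
      rw [hΛ]
      simp only [hk, hk']
      simp
  have h2 : ∀ N, (a : ℕ) ≤ N →
      ∑ k ∈ Finset.range N, (if (a : ℕ) ≤ k then Λ k - Λ (k + 1) else 0) = Λ a - Λ N := by
    intro N hN
    induction N, hN using Nat.le_induction with
    | base =>
      rw [sub_self]
      refine Finset.sum_eq_zero fun k hk => if_neg ?_
      have := Finset.mem_range.mp hk
      omega
    | succ N hN ih =>
      rw [Finset.sum_range_succ, ih, if_pos hN]
      ring
  have h3 := h2 n a.2.le
  rw [← Fin.sum_univ_eq_sum_range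
    (fun k => if (a : ℕ) ≤ k then Λ k - Λ (k + 1) else 0)] at h3
  simp only [h1, Fin.le_def]
  have ha : (⟨min (a : ℕ) (n - 1), by omega⟩ : Fin n) = a :=
    Fin.ext (show min (a : ℕ) (n - 1) = a by omega)
  have hlast : (⟨min n (n - 1), by omega⟩ : Fin n) = ⟨n - 1, Nat.sub_lt hn one_pos⟩ :=
    Fin.ext (show min n (n - 1) = n - 1 by omega)
  rw [h3, hΛ]
  simp only [ha, hlast]

theorem polyRep_single_of_ne (c : K) {a b : Fin n} (hab : a ≠ b) :
    polyRep c (Matrix.single a b (1 : K)) =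
      (polyDerivation (Matrix.single a b (1 : K)) :
        MvPolynomial (Fin n × ℕ) K →ₗ[K] MvPolynomial (Fin n × ℕ) K) := by
  change (polyDerivation (Matrix.single a b (1 : K)) :
    MvPolynomial (Fin n × ℕ) K →ₗ[K] MvPolynomial (Fin n × ℕ) K) + _ = _
  rw [Matrix.trace_single_eq_of_ne a b _ hab, mul_zero, zero_smul, add_zero]

theorem polyRep_sing (lam : Fin n → ℤ) (c : K) {a b : Fin n} (hab : a < b) :
    polyRep c (Matrix.single a b (1 : K)) (minorProduct K lam) = 0 := by
  rw [polyRep_single_of_ne c hab.ne, Derivation.coeFn_coe, minorProduct,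
    derivation_prod_pow_of_eigen _ _ _ _ 0 fun k _ => by
      rw [polyDerivation_minor_eq_zero hab.ne fun h => hab.le.trans h, Pi.zero_apply, zero_smul]]
  simp

/-- The minors account only for `lam a` minus the last entry of `lam`; the trace twist restores the
rest, including a negative last entry. -/
theorem polyRep_weight {lam : Fin n → ℤ} (hlam : Antitone lam) (hn : 0 < n) (a : Fin n) :
    polyRep (lam ⟨n - 1, Nat.sub_lt hn one_pos⟩ : K) (Matrix.single a a (1 : K))
      (minorProduct K lam) = (lam a : K) • minorProduct K lam := by
  change polyDerivation (Matrix.single a a (1 : K)) (minorProduct K lam) + (_ : K) • _ = _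
  rw [Matrix.trace_single_eq_same, mul_one, minorProduct,
    derivation_prod_pow_of_eigen _ _ _ _ _ fun k _ => polyDerivation_minor_diag,
    Module.End.one_apply, ← add_smul]
  congr 1
  have h := congrArg (Int.cast : ℤ → K) (sum_minorExponent hlam hn a)
  push_cast at h
  simp only [mul_ite, mul_one, mul_zero]
  rw [h]
  ring

/-- Among the minors, only the one with index `i` involves column `i` but not column `j`, so all the
others are killed. Two applications kill this one as well, so its exponent bounds the length of the
string. -/
theorem polyRep_nil (lam : Fin n → ℤ) (c : K) {i j : Fin n} (hij : (i : ℕ) + 1 = j) :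
    (polyRep c (Matrix.single j i (1 : K)) ^ ((lam i - lam j).toNat + 1)) (minorProduct K lam) =
      0 := by
  classical
  have hne : j ≠ i := fun h => by rw [h] at hij; omega
  have hexp : minorExponent lam i = (lam i - lam j).toNat := by
    have h : (i : ℕ) + 1 < n := hij ▸ j.2
    rw [minorExponent, dif_pos h]
    have hj : (⟨i + 1, h⟩ : Fin n) = j := Fin.ext hij
    rw [hj]
  rw [polyRep_single_of_ne c hne, minorProduct, ← Finset.mul_prod_erase _ _ (Finset.mem_univ i),
    hexp]
  refine derivation_pow_eq_zero _ (polyDerivation_polyDerivation_minor hne) _ _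
    (Nat.lt_succ_self _) _ ?_
  rw [derivation_prod_pow_of_eigen _ _ _ _ 0 fun k hk => by
      rw [polyDerivation_minor_eq_zero hne fun h => ?_, Pi.zero_apply, zero_smul]
      have h1 : (k : ℕ) ≠ i := fun h => Finset.ne_of_mem_erase hk (Fin.ext h)
      have h2 := Fin.le_def.mp h
      exact Fin.le_def.mpr (by omega)]
  simp

end Polynomials

end GlRep

end

/-! ### From matrix units to modules over the enveloping algebra. -/

noncomputable section

namespace WeylModP

section General

variable {K : Type*} [Field K] {L : Type*} [LieRing L] [LieAlgebra K L]

/-- The quotient is nonzero as soon as some representation contains a nonzero vector with the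
defining properties of the highest weight vector. -/
theorem nontrivial_weylQuotient {b : LieSubalgebra K L} {χ : L →ₗ[K] K} {S : Type*} {f : S → L}
    {m : S → ℕ} {A : Type*} [AddCommGroup A] [Module K A] (φ : L →ₗ⁅K⁆ Module.End K A) {v : A}
    (hv : v ≠ 0) (hb : ∀ x ∈ b, φ x v = χ x • v) (hf : ∀ s, (φ (f s) ^ (m s + 1)) v = 0) :
    Nontrivial (WeylQuotient K b χ f m) := by
  set Φ := UniversalEnvelopingAlgebra.lift K φ with hΦ
  have hι : ∀ x, Φ (UniversalEnvelopingAlgebra.ι K x) = φ x := fun x =>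
    UniversalEnvelopingAlgebra.lift_ι_apply K φ x
  -- `J` is the annihilator of `v`. It contains the Verma ideal, and its image contains the Weyl
  -- submodule; if the quotient were zero, `1` would lie in `J`.
  let J : Submodule (UniversalEnvelopingAlgebra K L) (UniversalEnvelopingAlgebra K L) :=
    { carrier := {u | Φ u v = 0}
      add_mem' := fun {x y} hx hy => by
        have hx : Φ x v = 0 := hx
        have hy : Φ y v = 0 := hy
        change Φ (x + y) v = 0
        rw [map_add, LinearMap.add_apply, hx, hy, add_zero]
      zero_mem' := by
        change Φ 0 v = 0
        rw [map_zero, LinearMap.zero_apply]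
      smul_mem' := fun c x hx => by
        have hx : Φ x v = 0 := hx
        change Φ (c * x) v = 0
        rw [map_mul, Module.End.mul_apply, hx, map_zero] }
  have hJ : vermaIdeal K b χ ≤ J := by
    refine Submodule.span_le.mpr ?_
    rintro _ ⟨x, hx, rfl⟩
    change Φ _ v = 0
    rw [map_sub, LinearMap.sub_apply, hι, hb x hx, AlgHom.commutes, Module.algebraMap_end_apply,
      sub_self]
  have hW : weylSubmodule K b χ f m ≤ J.map (vermaIdeal K b χ).mkQ := by
    refine Submodule.span_le.mpr ?_
    rintro _ ⟨s, rfl⟩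
    refine ⟨UniversalEnvelopingAlgebra.ι K (f s) ^ (m s + 1), ?_, ?_⟩
    · change Φ _ v = 0
      rw [map_pow, hι, hf]
    · change Submodule.Quotient.mk _ = _ • Submodule.Quotient.mk 1
      rw [← Submodule.Quotient.mk_smul, smul_eq_mul, mul_one]
  refine Submodule.Quotient.nontrivial_iff.mpr fun htop => hv ?_
  have h1 : highestWeightVector K b χ ∈ J.map (vermaIdeal K b χ).mkQ :=
    hW (by rw [htop]; trivial)
  obtain ⟨u, hu, hu1⟩ := h1
  have h2 : u - 1 ∈ J := hJ ((Submodule.Quotient.eq _).mp hu1)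
  have h3 : (1 : UniversalEnvelopingAlgebra K L) ∈ J := by
    have := J.sub_mem hu h2
    rwa [sub_sub_cancel] at this
  have h4 : Φ 1 v = 0 := h3
  rwa [map_one, Module.End.one_apply] at h4

/-- The universal enveloping algebra is generated by the Lie algebra. -/
theorem smul_mem_of_ι_smul_mem {M : Type*} [AddCommGroup M] [Module K M]
    [Module (UniversalEnvelopingAlgebra K L) M]
    [IsScalarTower K (UniversalEnvelopingAlgebra K L) M] {N : Submodule K M}
    (hN : ∀ x : L, ∀ y ∈ N, UniversalEnvelopingAlgebra.ι K x • y ∈ N)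
    (u : UniversalEnvelopingAlgebra K L) {y : M} (hy : y ∈ N) : u • y ∈ N := by
  let S : Subalgebra K (UniversalEnvelopingAlgebra K L) :=
    { carrier := {u | ∀ y ∈ N, u • y ∈ N}
      mul_mem' := fun {a b} ha hb y hy => by
        rw [mul_smul]
        exact ha _ (hb _ hy)
      add_mem' := fun {a b} ha hb y hy => by
        rw [add_smul]
        exact add_mem (ha _ hy) (hb _ hy)
      algebraMap_mem' := fun r y hy => by
        rw [algebraMap_smul]
        exact N.smul_mem r hy }
  let g : L →ₗ⁅K⁆ S :=
    { toFun := fun x => ⟨UniversalEnvelopingAlgebra.ι K x, hN x⟩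
      map_add' := fun x y => Subtype.ext (map_add _ x y)
      map_smul' := fun r x => Subtype.ext (map_smul _ r x)
      map_lie' := fun {x y} => Subtype.ext (by
        change UniversalEnvelopingAlgebra.ι K ⁅x, y⁆ = _
        rw [LieHom.map_lie]
        rfl) }
  -- By the universal property, the inclusion of the stabiliser `S` has a section, so `S` is the
  -- whole algebra.
  have hid : S.val.comp (UniversalEnvelopingAlgebra.lift K g) = AlgHom.id K _ := by
    refine UniversalEnvelopingAlgebra.hom_ext K (LieHom.ext fun x => ?_)
    change ((UniversalEnvelopingAlgebra.lift K g (UniversalEnvelopingAlgebra.ι K x) : S) :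
      UniversalEnvelopingAlgebra K L) = UniversalEnvelopingAlgebra.ι K x
    rw [UniversalEnvelopingAlgebra.lift_ι_apply]
    rfl
  have hu : ((UniversalEnvelopingAlgebra.lift K g u : S) : UniversalEnvelopingAlgebra K L) = u :=
    congrArg (fun h => h u) hid
  have := (UniversalEnvelopingAlgebra.lift K g u).2 y hy
  rwa [hu] at this

variable (K) in
/-- The action of the Lie algebra on a module over its universal enveloping algebra. -/
def lieAction (M : Type*) [AddCommGroup M] [Module K M]
    [Module (UniversalEnvelopingAlgebra K L) M]
    [IsScalarTower K (UniversalEnvelopingAlgebra K L) M] : L →ₗ⁅K⁆ Module.End K M :=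
  (AlgHom.toLieHom (Algebra.lsmul K K M)).comp (UniversalEnvelopingAlgebra.ι K)

theorem lieAction_apply {M : Type*} [AddCommGroup M] [Module K M]
    [Module (UniversalEnvelopingAlgebra K L) M]
    [IsScalarTower K (UniversalEnvelopingAlgebra K L) M] (x : L) (y : M) :
    lieAction K M x y = UniversalEnvelopingAlgebra.ι K x • y := rfl

theorem lieAction_pow_apply {M : Type*} [AddCommGroup M] [Module K M]
    [Module (UniversalEnvelopingAlgebra K L) M]
    [IsScalarTower K (UniversalEnvelopingAlgebra K L) M] (x : L) (k : ℕ) (y : M) :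
    (lieAction K M x ^ k) y = UniversalEnvelopingAlgebra.ι K x ^ k • y := by
  induction k with
  | zero => simp
  | succ k ih =>
    rw [pow_succ', Module.End.mul_apply, ih, lieAction_apply, ← mul_smul, ← pow_succ']

variable {b : LieSubalgebra K L} {χ : L →ₗ[K] K} {S : Type*} {f : S → L} {m : S → ℕ}

variable (K b χ f m) in
/-- The image of the highest weight vector. -/
def weylVector : WeylQuotient K b χ f m := Submodule.Quotient.mk (highestWeightVector K b χ)

theorem lieAction_weylVector {x : L} (hx : x ∈ b) :
    lieAction K _ x (weylVector K b χ f m) = χ x • weylVector K b χ f m := by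
  have h1 : UniversalEnvelopingAlgebra.ι K x • highestWeightVector K b χ =
      χ x • highestWeightVector K b χ := by
    rw [← algebraMap_smul (UniversalEnvelopingAlgebra K L) (χ x)]
    change UniversalEnvelopingAlgebra.ι K x • Submodule.Quotient.mk 1 =
      algebraMap K (UniversalEnvelopingAlgebra K L) (χ x) • Submodule.Quotient.mk 1
    rw [← Submodule.Quotient.mk_smul, ← Submodule.Quotient.mk_smul, Submodule.Quotient.eq,
      smul_eq_mul, mul_one, smul_eq_mul, mul_one]
    exact Submodule.subset_span ⟨x, hx, rfl⟩
  rw [lieAction_apply, weylVector, ← Submodule.Quotient.mk_smul, h1, Submodule.Quotient.mk_smul]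

theorem lieAction_pow_weylVector (s : S) :
    (lieAction K _ (f s) ^ (m s + 1)) (weylVector K b χ f m) = 0 := by
  rw [lieAction_pow_apply, weylVector, ← Submodule.Quotient.mk_smul,
    Submodule.Quotient.mk_eq_zero]
  exact Submodule.subset_span ⟨s, rfl⟩

theorem eq_top_of_weylVector_mem {N : Submodule K (WeylQuotient K b χ f m)}
    (hv : weylVector K b χ f m ∈ N) (hN : ∀ x : L, ∀ y ∈ N, lieAction K _ x y ∈ N) : N = ⊤ := by
  refine eq_top_iff.mpr fun y _ => ?_
  obtain ⟨y, rfl⟩ := Submodule.Quotient.mk_surjective _ y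
  obtain ⟨u, rfl⟩ := Submodule.Quotient.mk_surjective _ y
  have h1 := smul_mem_of_ι_smul_mem hN u hv
  rwa [weylVector, highestWeightVector, ← Submodule.Quotient.mk_smul,
    ← Submodule.Quotient.mk_smul, smul_eq_mul, mul_one] at h1

end General

/-! ### The Weyl modules of `gl_n` and `sl_n`. -/

section TypeA

variable {K : Type*} [Field K] {n : ℕ}

theorem isMatrixUnits_of_lieHom {V : Type*} [AddCommGroup V] [Module K V]
    (ψ : Matrix (Fin n) (Fin n) K →ₗ⁅K⁆ Module.End K V) :
    GlRep.IsMatrixUnits fun i j => ψ (Matrix.single i j 1) := by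
  intro a b c d
  rw [← Ring.lie_def, ← LieHom.map_lie, Ring.lie_def, map_sub]
  congr 1
  · split_ifs with h
    · rw [h, Matrix.single_mul_single_same, mul_one]
    · rw [Matrix.single_mul_single_of_ne _ _ _ _ h, map_zero]
  · split_ifs with h
    · rw [h, Matrix.single_mul_single_same, mul_one]
    · rw [Matrix.single_mul_single_of_ne _ _ _ _ h, map_zero]

theorem map_mem_of_single {V : Type*} [AddCommGroup V] [Module K V]
    (ψ : Matrix (Fin n) (Fin n) K →ₗ⁅K⁆ Module.End K V) {N : Submodule K V} {y : V}
    (h : ∀ i j, ψ (Matrix.single i j 1) y ∈ N) (x : Matrix (Fin n) (Fin n) K) : ψ x y ∈ N := by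
  have hx : x = ∑ i, ∑ j, x i j • Matrix.single i j (1 : K) := by
    conv_lhs => rw [Matrix.matrix_eq_sum_single x]
    simp
  rw [hx]
  simp only [map_sum, map_smul, LinearMap.sum_apply, LinearMap.smul_apply]
  exact sum_mem fun i _ => sum_mem fun j _ => N.smul_mem _ (h i j)

theorem apply_eq_glWeight {V : Type*} [AddCommGroup V] [Module K V]
    (ψ : Matrix (Fin n) (Fin n) K →ₗ⁅K⁆ Module.End K V) {v : V} {lam : Fin n → ℤ}
    (hs : ∀ i j, i < j → ψ (Matrix.single i j 1) v = 0)
    (hw : ∀ i, ψ (Matrix.single i i 1) v = (lam i : K) • v) {x : Matrix (Fin n) (Fin n) K}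
    (hx : x ∈ glBorel K n) : ψ x v = glWeight K lam x • v := by
  have hx' : x = ∑ i, ∑ j, x i j • Matrix.single i j (1 : K) := by
    conv_lhs => rw [Matrix.matrix_eq_sum_single x]
    simp
  have hrow : ∀ i, ∑ j, x i j • ψ (Matrix.single i j (1 : K)) v = ((lam i : K) * x i i) • v := by
    intro i
    rw [Finset.sum_eq_single i, hw, smul_smul, mul_comm]
    · intro j _ hj
      rcases lt_or_gt_of_ne hj with h | h
      · rw [hx i j h, zero_smul]
      · rw [hs i j h, smul_zero]
    · simp
  conv_lhs => rw [hx']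
  simp only [map_sum, map_smul, LinearMap.sum_apply, LinearMap.smul_apply, hrow]
  rw [← Finset.sum_smul, glWeight]
  simp [LinearMap.sum_apply]

/-- The action `ψ` of `gl_n` is kept separate from that of `L` so that both cases are covered: for
`gl_n` they coincide, for `sl_n` `ψ` is an extension with the same stable subspaces. -/
theorem isSimpleModule_weylQuotient {p : ℕ} [Fact p.Prime] [CharP K p] [Infinite K] {L : Type*}
    [LieRing L] [LieAlgebra K L] {b : LieSubalgebra K L} {χ : L →ₗ[K] K} {f : SimpleRoot n → L}
    {lam : Fin n → ℤ} (hlam : Antitone lam) (hn : 0 < n)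
    (hp : lam ⟨0, hn⟩ - lam ⟨n - 1, Nat.sub_lt hn one_pos⟩ + (n : ℤ) < (p : ℤ))
    [Nontrivial (WeylQuotient K b χ f (label lam))]
    (ψ : Matrix (Fin n) (Fin n) K →ₗ⁅K⁆ Module.End K (WeylQuotient K b χ f (label lam)))
    (hs : ∀ i j, i < j → ψ (Matrix.single i j 1) (weylVector K b χ f (label lam)) = 0)
    (hw : ∀ i, ψ (Matrix.single i i 1) (weylVector K b χ f (label lam)) =
      (lam i : K) • weylVector K b χ f (label lam))
    (hf : ∀ s, ψ (glF K s) = lieAction K _ (f s))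
    (hψ : ∀ N : Submodule K (WeylQuotient K b χ f (label lam)),
      (∀ x, ∀ y ∈ N, ψ x y ∈ N) ↔ ∀ x : L, ∀ y ∈ N, lieAction K _ x y ∈ N) :
    IsSimpleModule (UniversalEnvelopingAlgebra K L) (WeylQuotient K b χ f (label lam)) := by
  have hv : GlRep.IsWeylVector (fun i j => ψ (Matrix.single i j 1)) lam
      (weylVector K b χ f (label lam)) := by
    refine ⟨isMatrixUnits_of_lieHom ψ, hs, hw, fun i j hij => ?_⟩
    have h1 := lieAction_pow_weylVector (b := b) (χ := χ) (f := f) (m := label lam)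
      (⟨(i, j), hij⟩ : SimpleRoot n)
    rwa [← hf] at h1
  refine (isSimpleModule_iff _ _).mpr { eq_bot_or_eq_top := fun N => ?_ }
  rw [or_iff_not_imp_left]
  intro hN
  have htop := hv.eq_top (N := N.restrictScalars K) hlam ⟨0, hn⟩
    ⟨n - 1, Nat.sub_lt hn one_pos⟩ (fun i => Fin.le_def.mpr (Nat.zero_le _))
    (fun i => Fin.le_def.mpr (Nat.le_sub_one_of_lt i.2)) hp ?_ ?_ ?_
  · rwa [Submodule.restrictScalars_eq_top_iff] at htop
  · intro N' hvN hN'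
    exact eq_top_of_weylVector_mem hvN ((hψ N').mp fun x y hy =>
      map_mem_of_single ψ (fun i j => hN' i j y hy) x)
  · intro i j y hy
    exact (hψ (N.restrictScalars K)).mpr (fun x y hy => N.smul_mem _ hy) _ y hy
  · rwa [Ne, Submodule.restrictScalars_eq_bot_iff]

theorem exists_gl_rep (K : Type*) [Field K] {lam : Fin n → ℤ} (hlam : Antitone lam) (hn : 0 < n) :
    ∃ (φ : Matrix (Fin n) (Fin n) K →ₗ⁅K⁆ Module.End K (MvPolynomial (Fin n × ℕ) K))
      (v : MvPolynomial (Fin n × ℕ) K), v ≠ 0 ∧ (∀ x ∈ glBorel K n, φ x v = glWeight K lam x • v) ∧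
        ∀ s, (φ (glF K s) ^ (label lam s + 1)) v = 0 :=
  ⟨_, _, GlRep.minorProduct_ne_zero lam, fun _ hx => apply_eq_glWeight _
    (fun _ _ hij => GlRep.polyRep_sing lam _ hij) (GlRep.polyRep_weight hlam hn) hx,
    fun s => GlRep.polyRep_nil lam _ s.2⟩

theorem single_mem_glBorel {i j : Fin n} (hij : i ≤ j) :
    Matrix.single i j (1 : K) ∈ glBorel K n := by
  intro a b hab
  rw [Matrix.single_apply, if_neg]
  rintro ⟨rfl, rfl⟩
  exact absurd hab hij.not_gt

theorem glWeight_single (lam : Fin n → ℤ) (i j : Fin n) :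
    glWeight K lam (Matrix.single i j 1) = if i = j then (lam i : K) else 0 := by
  rw [glWeight, LinearMap.sum_apply, Finset.sum_eq_single i]
  · by_cases h : i = j
    · simp [h]
    · simp [h, Ne.symm h]
  · intro k _ hk
    simp [Ne.symm hk]
  · simp

theorem isSimpleModule_glWeylModule {p : ℕ} [Fact p.Prime] [CharP K p] [Infinite K]
    {lam : Fin n → ℤ} (hlam : Antitone lam) (hn : 0 < n)
    (hp : lam ⟨0, hn⟩ - lam ⟨n - 1, Nat.sub_lt hn one_pos⟩ + (n : ℤ) < (p : ℤ)) :
    IsSimpleModule (UniversalEnvelopingAlgebra K (Matrix (Fin n) (Fin n) K))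
      (GlWeylModule K lam) := by
  obtain ⟨φ, v, hv, hb, hf⟩ := exists_gl_rep K hlam hn
  have : Nontrivial (GlWeylModule K lam) := nontrivial_weylQuotient φ hv hb hf
  refine isSimpleModule_weylQuotient hlam hn hp (lieAction K _) ?_ ?_ (fun _ => rfl)
    fun _ => Iff.rfl
  · intro i j hij
    rw [lieAction_weylVector (single_mem_glBorel hij.le), glWeight_single, if_neg hij.ne,
      zero_smul]
  · intro i
    rw [lieAction_weylVector (single_mem_glBorel le_rfl), glWeight_single, if_pos rfl]

/-- The projection of `gl_n` onto `sl_n`, when `n` is invertible. -/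
def slProj (hn : (n : K) ≠ 0) :
    Matrix (Fin n) (Fin n) K →ₗ⁅K⁆ LieAlgebra.SpecialLinear.sl (Fin n) K where
  toFun x := ⟨x - ((n : K)⁻¹ * x.trace) • 1, by
    change Matrix.trace (_ : Matrix (Fin n) (Fin n) K) = 0
    rw [Matrix.trace_sub, Matrix.trace_smul, Matrix.trace_one, Fintype.card_fin, smul_eq_mul,
      mul_right_comm, inv_mul_cancel₀ hn, one_mul, sub_self]⟩
  map_add' x y := Subtype.ext (by
    change _ = (x - _) + (y - _)
    simp only [Matrix.trace_add, mul_add, add_smul]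
    abel)
  map_smul' r x := Subtype.ext (by
    change _ = r • (x - _)
    simp only [Matrix.trace_smul, smul_sub, smul_smul, smul_eq_mul, mul_left_comm])
  map_lie' {x y} := Subtype.ext (by
    rw [LieSubalgebra.coe_bracket]
    simp only [Ring.lie_def, Matrix.trace_sub, Matrix.trace_mul_comm y x, sub_self, mul_zero,
      zero_smul, sub_zero]
    simp only [sub_mul, mul_sub, smul_mul_assoc, mul_smul_comm, one_mul, mul_one]
    module)

theorem coe_slProj (hn : (n : K) ≠ 0) (x : Matrix (Fin n) (Fin n) K) :
    (slProj hn x : Matrix (Fin n) (Fin n) K) = x - ((n : K)⁻¹ * x.trace) • 1 := rfl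

theorem slProj_coe (hn : (n : K) ≠ 0) (x : LieAlgebra.SpecialLinear.sl (Fin n) K) :
    slProj hn x = x := by
  have hx : Matrix.trace (x : Matrix (Fin n) (Fin n) K) = 0 := x.2
  refine Subtype.ext ?_
  rw [coe_slProj, hx, mul_zero, zero_smul, sub_zero]

theorem slProj_mem_slBorel (hn : (n : K) ≠ 0) {x : Matrix (Fin n) (Fin n) K}
    (hx : x ∈ glBorel K n) : slProj hn x ∈ slBorel K n := by
  intro i j hij
  change (slProj hn x : Matrix (Fin n) (Fin n) K) i j = 0
  rw [coe_slProj, Matrix.sub_apply, hx i j hij, Matrix.smul_apply, Matrix.one_apply_ne hij.ne',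
    smul_zero, sub_zero]

/-- A representation of `sl_n`, extended to `gl_n` with the identity matrix acting by `n * c`. -/
def extendToGl {V : Type*} [AddCommGroup V] [Module K V] (hn : (n : K) ≠ 0)
    (φ : LieAlgebra.SpecialLinear.sl (Fin n) K →ₗ⁅K⁆ Module.End K V) (c : K) :
    Matrix (Fin n) (Fin n) K →ₗ⁅K⁆ Module.End K V where
  toFun x := φ (slProj hn x) + (c * x.trace) • 1
  map_add' x y := by
    rw [map_add, map_add, Matrix.trace_add, mul_add, add_smul]
    abel
  map_smul' r x := by
    rw [map_smul, map_smul, Matrix.trace_smul, RingHom.id_apply, smul_add, smul_smul, smul_eq_mul,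
      mul_left_comm]
  map_lie' {x y} := by
    have htr : Matrix.trace ⁅x, y⁆ = 0 := by
      rw [Ring.lie_def, Matrix.trace_sub, Matrix.trace_mul_comm, sub_self]
    rw [htr, mul_zero, zero_smul, add_zero, LieHom.map_lie, LieHom.map_lie, Ring.lie_def,
      Ring.lie_def]
    simp only [add_mul, mul_add, smul_mul_assoc, mul_smul_comm, one_mul, mul_one]
    module

theorem extendToGl_apply {V : Type*} [AddCommGroup V] [Module K V] (hn : (n : K) ≠ 0)
    (φ : LieAlgebra.SpecialLinear.sl (Fin n) K →ₗ⁅K⁆ Module.End K V) (c : K)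
    (x : Matrix (Fin n) (Fin n) K) (y : V) :
    extendToGl hn φ c x y = φ (slProj hn x) y + (c * x.trace) • y := rfl

theorem isSimpleModule_slWeylModule {p : ℕ} [Fact p.Prime] [CharP K p] [Infinite K]
    {lam : Fin n → ℤ} (hlam : Antitone lam) (hn : 0 < n)
    (hp : lam ⟨0, hn⟩ - lam ⟨n - 1, Nat.sub_lt hn one_pos⟩ + (n : ℤ) < (p : ℤ)) :
    IsSimpleModule (UniversalEnvelopingAlgebra K (LieAlgebra.SpecialLinear.sl (Fin n) K))
      (SlWeylModule K lam) := by
  have hnK : (n : K) ≠ 0 := by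
    rw [Ne, CharP.cast_eq_zero_iff K p]
    intro hdvd
    have h1 := Nat.le_of_dvd hn hdvd
    have h2 : lam ⟨n - 1, Nat.sub_lt hn one_pos⟩ ≤ lam ⟨0, hn⟩ :=
      hlam (Fin.le_def.mpr (Nat.zero_le _))
    omega
  obtain ⟨φ, v, hv, hb, hf⟩ := exists_gl_rep K hlam hn
  have : Nontrivial (SlWeylModule K lam) := nontrivial_weylQuotient
    (φ.comp (LieAlgebra.SpecialLinear.sl (Fin n) K).incl) hv (fun x hx => hb x hx) hf
  -- This choice makes the identity matrix act by `∑ λ_i`, its value under `glWeight`.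
  set c : K := (n : K)⁻¹ * ∑ i, (lam i : K) with hc
  have hweight : ∀ x ∈ glBorel K n, extendToGl hnK (lieAction K _) c x
      (weylVector K (slBorel K n) (slWeight K lam) (slF K) (label lam)) = glWeight K lam x •
        weylVector K (slBorel K n) (slWeight K lam) (slF K) (label lam) := by
    intro x hx
    rw [extendToGl_apply, lieAction_weylVector (slProj_mem_slBorel hnK hx), ← add_smul]
    congr 1
    change glWeight K lam (slProj hnK x : Matrix (Fin n) (Fin n) K) + _ = _
    have hone : glWeight K lam (1 : Matrix (Fin n) (Fin n) K) = ∑ i, (lam i : K) := by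
      simp [glWeight, LinearMap.sum_apply]
    rw [coe_slProj, map_sub, map_smul, hone, hc, smul_eq_mul]
    ring
  have hsl : ∀ x : LieAlgebra.SpecialLinear.sl (Fin n) K,
      extendToGl hnK (lieAction K (SlWeylModule K lam)) c x = lieAction K _ x := by
    intro x
    have hx : Matrix.trace (x : Matrix (Fin n) (Fin n) K) = 0 := x.2
    refine LinearMap.ext fun y => ?_
    rw [extendToGl_apply, slProj_coe, hx, mul_zero, zero_smul, add_zero]
  refine isSimpleModule_weylQuotient hlam hn hp (extendToGl hnK (lieAction K _) c) ?_ ?_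
    (fun s => hsl (slF K s)) fun N => ⟨?_, ?_⟩
  · intro i j hij
    rw [hweight _ (single_mem_glBorel hij.le), glWeight_single, if_neg hij.ne, zero_smul]
  · intro i
    rw [hweight _ (single_mem_glBorel le_rfl), glWeight_single, if_pos rfl]
  · intro h x y hy
    rw [← hsl]
    exact h x y hy
  · intro h x y hy
    rw [extendToGl_apply]
    exact add_mem (h _ y hy) (N.smul_mem _ hy)

end TypeA

end WeylModP

end
theorem lemma3p1p2 (n : ℕ) (hn : 0 < n) (lam : Fin n → ℤ) (hlam : Antitone lam)
    (p : ℕ) [Fact p.Prime]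
    (hp : lam ⟨0, hn⟩ - lam ⟨n - 1, Nat.sub_lt hn one_pos⟩ + (n : ℤ) < (p : ℤ)) :
    IsSimpleModule
        (UniversalEnvelopingAlgebra (AlgebraicClosure (ZMod p))
          (LieAlgebra.SpecialLinear.sl (Fin n) (AlgebraicClosure (ZMod p))))
        (WeylModP.SlWeylModule (AlgebraicClosure (ZMod p)) lam) ∧
      IsSimpleModule
        (UniversalEnvelopingAlgebra (AlgebraicClosure (ZMod p))
          (Matrix (Fin n) (Fin n) (AlgebraicClosure (ZMod p))))
        (WeylModP.GlWeylModule (AlgebraicClosure (ZMod p)) lam) := by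
  have : CharP (AlgebraicClosure (ZMod p)) p :=
    charP_of_injective_algebraMap (algebraMap (ZMod p) _).injective p
  have : Infinite (AlgebraicClosure (ZMod p)) := IsAlgClosed.instInfinite
  exact ⟨WeylModP.isSimpleModule_slWeylModule hlam hn hp,
    WeylModP.isSimpleModule_glWeylModule hlam hn hp⟩
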